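/- Let $d\ge 1$ and let $D\subset\mathbb R^d$ be the closure of a nonempty open, bounded, convex set; let $a,b\in D$. Let $p>1$ and let $f:D\times\mathbb R^d\to[0,\infty)$ satisfy: - $f$ is continuous on $D\times\mathbb R^d$ and $C^1$ on $D\times(\mathbb R^d\setminus\{0\})$; - $v\mapsto f(x,v)$ is convex for every $x\in D$; - $f(x,\lambda v)=\lambda^p f(x,v)$ for all $x\in D$, $v\in\mathbb R^d$, $\lambda>0$; - there are constants $m_1,m_2>0$ with $m_1|v|^p\le f(x,v)\le m_2|v|^p$ for all $x\in D$, $v\in\mathbb R^d$; - (Lip) there is a constant $c$ with $|f(x,v)-f(y,v)|\le c\,|x-y|\,|v|^p$ for all $x,y\in D$, $v\in\mathbb R^d$. Let $\Omega(a,b)$ be the set of Lipschitz paths $\gamma:[0,1]\to D$ with $\gamma(0)=a$, $\gamma(1)=b$, let $F(\gamma)=\int_0^1 f(\gamma(t),\dot\gamma(t))\,dt$ for $\gamma\in\Omega(a,b)$, and let $S_\gamma=\gamma([0,1])$. Let $X_1,X_2,\ldots$ be i.i.d. random points of $D$ whose law has a density $\rho$ with respect to Lebesgue measure on $D$ such that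 $c_0\le\rho\le c_0^{-1}$ on $D$ for some $c_0>0$. Let $\epsilon_n>0$ satisfy $\epsilon_n\to0$ and $\frac{(\log n)^{1/d}}{n^{1/d}}\frac1{\epsilon_n}\to 0$ as $n\to\infty$. Let $\mathcal G_n(a,b)$ be the graph with vertex set $\{X_1,\ldots,X_n\}\cup\{a,b\}$ and an edge between $u$ and $v$ iff $0<|u-v|<\epsilon_n$. Let $V_n(a,b)$ be the set of finite sequences $\mathbf v=(v_0,\ldots,v_m)$, $m\ge1$, of vertices with $v_0=a$, $v_m=b$ and an edge between $v_i$ and $v_{i+1}$ for $0\le i<m$. For such $\mathbf v$ put $$H_n(\mathbf v)=\frac1m\sum_{i=0}^{m-1}f\bigl(v_i,\,m(v_{i+1}-v_i)\bigr),$$ and let $l_{\mathbf v}:[0,1]\to D$ be the piecewise linear interpolation $l_{\mathbf v}(t)=(1-(mt-i))\,v_i+(mt-i)\,v_{i+1}$ for $i/m\le t\le(i+1)/m$. Then $F$ attains its minimum on $\Omega(a,b)$ and, for all realizations $\{X_i\}$ in a set of probability one, the following holds. 1. For all large $n$ the functional $H_n$ attains its minimum on $V_n(a,b)$ (in particular $V_n(a,b)\neq\emptyset$),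 and $$\lim_{n\to\infty}\ \min_{\mathbf v\in V_n(a,b)}H_n(\mathbf v)=\min_{\gamma\in\Omega(a,b)}F(\gamma).$$ 2. Let $\mathbf w^{(n)}\in\operatorname{argmin}H_n$ for all large $n$. Every subsequence of $(\mathbf w^{(n)})$ has a further subsequence $(\mathbf w^{(n_k)})$ for which there is a minimizer $\gamma\in\operatorname{argmin}F$ such that $l_{\mathbf w^{(n_k)}}\to\gamma$ uniformly on $[0,1]$ and the vertex sets of $\mathbf w^{(n_k)}$ converge to $S_\gamma$ in the Hausdorff distance. 3. If $F$ has a unique minimizer $\gamma$ on $\Omega(a,b)$, then for the whole sequence $l_{\mathbf w^{(n)}}\to\gamma$ uniformly on $[0,1]$ and the vertex sets of $\mathbf w^{(n)}$ converge to $S_\gamma$ in the Hausdorff distance. -/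

import Mathlib

open MeasureTheory ProbabilityTheory Filter Set Topology

noncomputable section

namespace GeodesicApprox

/-- `ℝᵈ` with its Euclidean norm. -/
abbrev Euc (d : ℕ) : Type := EuclideanSpace ℝ (Fin d)

/-- `D` is the closure of a (nonempty) open, bounded, convex set. -/
def IsConvexDomain {d : ℕ} (D : Set (Euc d)) : Prop :=
  ∃ U : Set (Euc d), U.Nonempty ∧ IsOpen U ∧ Bornology.IsBounded U ∧ Convex ℝ U ∧ D = closure U

/-- The standing assumptions on the integrand `f : D × ℝᵈ → [0, ∞)`, with homogeneity degree `p`.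
Only the values `f x v` with `x ∈ D` are constrained; nonnegativity follows from `bounds`. -/
structure IsIntegrand {d : ℕ} (D : Set (Euc d)) (p : ℝ) (f : Euc d → Euc d → ℝ) : Prop where
  /-- `f` is continuous on `D × ℝᵈ`. -/
  continuousOn : ContinuousOn (fun z : Euc d × Euc d => f z.1 z.2) (D ×ˢ univ)
  /-- `f` is `C¹` on `D × (ℝᵈ \ {0})`. -/
  contDiffOn : ContDiffOn ℝ 1 (fun z : Euc d × Euc d => f z.1 z.2) (D ×ˢ {0}ᶜ)
  /-- `f` is convex in `v`. -/
  convex : ∀ x ∈ D, ConvexOn ℝ univ (f x)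
  /-- `f` is `p`-homogeneous in `v`. -/
  homogeneous : ∀ x ∈ D, ∀ v : Euc d, ∀ r : ℝ, 0 < r → f x (r • v) = r ^ p * f x v
  /-- `f` is comparable to `|v| ^ p`. -/
  bounds : ∃ m₁ m₂ : ℝ, 0 < m₁ ∧ 0 < m₂ ∧
    ∀ x ∈ D, ∀ v : Euc d, m₁ * ‖v‖ ^ p ≤ f x v ∧ f x v ≤ m₂ * ‖v‖ ^ p

/-- The condition (Lip). -/
def LipCondition {d : ℕ} (D : Set (Euc d)) (p : ℝ) (f : Euc d → Euc d → ℝ) : Prop :=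
  ∃ c : ℝ, ∀ x ∈ D, ∀ y ∈ D, ∀ v : Euc d, |f x v - f y v| ≤ c * ‖x - y‖ * ‖v‖ ^ p

/-- `Ω(a,b)`: Lipschitz paths `[0,1] → D` from `a` to `b`. A path is given by a function on `ℝ`
of which only the restriction to `[0,1]` matters. -/
def lipPaths {d : ℕ} (D : Set (Euc d)) (a b : Euc d) : Set (ℝ → Euc d) :=
  {γ | (∃ K : NNReal, LipschitzOnWith K γ (Icc 0 1)) ∧ MapsTo γ (Icc 0 1) D ∧ γ 0 = a ∧ γ 1 = b}

/-- `F(γ) = ∫₀¹ f(γ(t), γ'(t)) dt`. -/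
def pathCost {d : ℕ} (f : Euc d → Euc d → ℝ) (γ : ℝ → Euc d) : ℝ :=
  ∫ t in (0 : ℝ)..1, f (γ t) (deriv γ t)

/-- The minimizers of `J` over the set `S`. -/
def argminOn {α : Type*} (J : α → ℝ) (S : Set α) : Set α :=
  {x | x ∈ S ∧ ∀ y ∈ S, J x ≤ J y}

/-- A finite sequence `(v₀, …, v_m)`, with `m = steps`. The values `vertex i`
for `i > steps` play no role. -/
structure DiscretePath (d : ℕ) where
  steps : ℕ
  vertex : ℕ → Euc d

/-- The set of points `{v₀, …, v_m}`. -/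
def DiscretePath.points {d : ℕ} (v : DiscretePath d) : Set (Euc d) :=
  {x | ∃ i ≤ v.steps, v.vertex i = x}

/-- Vertex set of the random geometric graph: the first `n` sample points together with `a, b`. -/
def graphVertices {d : ℕ} (x : ℕ → Euc d) (n : ℕ) (a b : Euc d) : Set (Euc d) :=
  {y | ∃ i < n, x i = y} ∪ {a, b}

/-- The `ε`-graph on the first `n` sample points and `a, b`: there is an edge between
two vertices `u, v` iff `0 < |u - v| < ε` (other points of `ℝᵈ` are isolated). -/
def epsGraph {d : ℕ} (x : ℕ → Euc d) (n : ℕ) (ε : ℝ) (a b : Euc d) : SimpleGraph (Euc d) where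
  Adj u v := u ∈ graphVertices x n a b ∧ v ∈ graphVertices x n a b ∧ 0 < dist u v ∧ dist u v < ε
  symm := ⟨fun u v h => ⟨h.2.1, h.1, by rw [dist_comm]; exact h.2.2.1,
    by rw [dist_comm]; exact h.2.2.2⟩⟩
  loopless := ⟨fun u h => by simpa using h.2.2.1⟩

/-- `V_n(a,b)`: paths with `m ≥ 1` steps from `a` to `b` in the `ε`-graph. -/
def graphPaths {d : ℕ} (x : ℕ → Euc d) (n : ℕ) (ε : ℝ) (a b : Euc d) : Set (DiscretePath d) :=
  {v | 1 ≤ v.steps ∧ v.vertex 0 = a ∧ v.vertex v.steps = b ∧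
    ∀ i < v.steps, (epsGraph x n ε a b).Adj (v.vertex i) (v.vertex (i + 1))}

/-- `H(v) = (1/m) ∑_{i=0}^{m-1} f(v_i, m (v_{i+1} - v_i))`. -/
def riemannCost {d : ℕ} (f : Euc d → Euc d → ℝ) (v : DiscretePath d) : ℝ :=
  (1 / (v.steps : ℝ)) * ∑ i ∈ Finset.range v.steps,
    f (v.vertex i) ((v.steps : ℝ) • (v.vertex (i + 1) - v.vertex i))

/-- The piecewise linear interpolation of `(v₀, …, v_m)` on `[0,1]`, each segment being traversed
in time `1/m`. At `t = 1` the formula gives `v_m`. -/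
def linInterp {d : ℕ} (v : DiscretePath d) (t : ℝ) : Euc d :=
  let i : ℕ := ⌊(v.steps : ℝ) * t⌋₊
  (1 - ((v.steps : ℝ) * t - i)) • v.vertex i + ((v.steps : ℝ) * t - i) • v.vertex (i + 1)

/-- On `[i/m, (i+1)/m]` the interpolation is the segment from `v_i` to `v_{i+1}`. -/
theorem linInterp_eq {d : ℕ} (v : DiscretePath d) (i : ℕ) (hi : i < v.steps) (t : ℝ)
    (h₁ : (i : ℝ) / v.steps ≤ t) (h₂ : t ≤ ((i : ℝ) + 1) / v.steps) :
    linInterp v t = (1 - ((v.steps : ℝ) * t - i)) • v.vertex i +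
      ((v.steps : ℝ) * t - i) • v.vertex (i + 1) := by
  have hm : (0 : ℝ) < v.steps := by exact_mod_cast (Nat.zero_le i).trans_lt hi
  rw [div_le_iff₀ hm] at h₁
  rw [le_div_iff₀ hm] at h₂
  rcases h₂.lt_or_eq with h | h
  · have hf : ⌊(v.steps : ℝ) * t⌋₊ = i := by
      rw [Nat.floor_eq_iff (by nlinarith [Nat.cast_nonneg (α := ℝ) i])]
      constructor <;> linarith
    simp only [linInterp, hf]
  · have h' : (v.steps : ℝ) * t = ((i + 1 : ℕ) : ℝ) := by push_cast; linarith
    simp only [linInterp, h', Nat.floor_natCast]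
    simp

/-- `v_k → γ` along the sequence, in both senses: the linear interpolations converge uniformly
on `[0,1]` to `γ`, and the vertex sets converge to the image `S_γ` in Hausdorff distance. -/
def ConvergesTo {d : ℕ} (v : ℕ → DiscretePath d) (γ : ℝ → Euc d) : Prop :=
  TendstoUniformlyOn (fun k => linInterp (v k)) γ atTop (Icc 0 1) ∧
    Tendsto (fun k => Metric.hausdorffDist (v k).points (γ '' Icc 0 1)) atTop (𝓝 0)

end GeodesicApprox

end

/-! The argument is a Γ-convergence proof in which uniformly Lipschitz paths replace weak
convergence of derivatives.

Discrete and continuous costs are compared in two ways. For a discrete path of mesh `δ`, condition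
(Lip) and the lower growth bound give `|F(l_v) - H(v)| ≤ (c δ / m₁) H(v)`
(`abs_pathCost_linInterp_sub_le`). Since `l_v` is a competitor for `F`, this bounds `min H_n` below.
Conversely, Jensen's inequality shows that sampling a `K`-Lipschitz path at the times `i / m` raises
its cost by at most `c K ^ (p + 1) / m` (`riemannCost_samplePath_le`). With `m` of order `1 / ε_n`
and each sampled point moved to a vertex at distance `o(ε_n)`, the velocities change by `o(1)`,
which bounds `min H_n` above (`eventually_exists_graphPath`). The vertices are dense enough almost
surely, by a union bound over a finite net and Borel–Cantelli (`ae_eventually_cover`).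

For compactness, a bound on `H(w)` gives no uniform Lipschitz bound on `l_w`. The polygon is
therefore reparametrized proportionally to its `f ^ (1 / p)`-length `L`
(`exists_reparametrization`). The new path `η` has Lipschitz constant `L / m₁ ^ (1 / p)`, and the
power mean inequality gives `F(η) ≤ (1 + o(1)) L ^ p ≤ (1 + o(1)) H(w)`. Arzelà–Ascoli and lower
semicontinuity (`pathCost_le_of_tendsto`) then produce a minimizer; the same device proves that `F`
attains its minimum. For minimizing `w`, both `L ^ p` and `H(w)` tend to `min F`. The power mean
inequality is then asymptotically an equality, so by strict convexity of `x ^ p` the edges have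
nearly equal length on average. Hence `l_w` and `η` are uniformly close and share their limit. -/

namespace GeodesicApprox

/-! ### Bounds on the integrand, and Jensen's inequality for sampled paths -/

/-- The quantitative hypotheses on the integrand, with explicit constants. -/
structure CostBounds {d : ℕ} (D : Set (Euc d)) (p : ℝ) (f : Euc d → Euc d → ℝ)
    (m₁ m₂ c : ℝ) : Prop where
  isCompact : IsCompact D
  convexDomain : Convex ℝ D
  one_lt : 1 < p
  m₁_pos : 0 < m₁
  m₂_pos : 0 < m₂
  c_nonneg : 0 ≤ c
  continuousOn : ContinuousOn (fun z : Euc d × Euc d => f z.1 z.2) (D ×ˢ univ)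
  convex : ∀ x ∈ D, ConvexOn ℝ univ (f x)
  homogeneous : ∀ x ∈ D, ∀ v : Euc d, ∀ r : ℝ, 0 < r → f x (r • v) = r ^ p * f x v
  lower : ∀ x ∈ D, ∀ v : Euc d, m₁ * ‖v‖ ^ p ≤ f x v
  upper : ∀ x ∈ D, ∀ v : Euc d, f x v ≤ m₂ * ‖v‖ ^ p
  lip : ∀ x ∈ D, ∀ y ∈ D, ∀ v : Euc d, |f x v - f y v| ≤ c * ‖x - y‖ * ‖v‖ ^ p

theorem exists_costBounds {d : ℕ} {D : Set (Euc d)} (hD : IsConvexDomain D) {p : ℝ} (hp : 1 < p)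
    {f : Euc d → Euc d → ℝ} (hf : IsIntegrand D p f) (hLip : LipCondition D p f) :
    ∃ m₁ m₂ c : ℝ, CostBounds D p f m₁ m₂ c := by
  obtain ⟨U, -, -, hUb, hUc, rfl⟩ := hD
  obtain ⟨m₁, m₂, h₁, h₂, hb⟩ := hf.bounds
  obtain ⟨c, hc⟩ := hLip
  refine ⟨m₁, m₂, max c 0, ⟨hUb.isCompact_closure, hUc.closure, hp, h₁, h₂, le_max_right _ _,
    hf.continuousOn, hf.convex, hf.homogeneous, fun x hx v => (hb x hx v).1,
    fun x hx v => (hb x hx v).2, fun x hx y hy v => (hc x hx y hy v).trans ?_⟩⟩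
  gcongr
  exact le_max_left _ _

/-- The discrete path obtained by sampling `γ` at the times `i / m`. -/
noncomputable def samplePath {d : ℕ} (γ : ℝ → Euc d) (m : ℕ) : DiscretePath d :=
  ⟨m, fun i => γ ((i : ℝ) / m)⟩

namespace CostBounds

variable {d : ℕ} {D : Set (Euc d)} {p : ℝ} {f : Euc d → Euc d → ℝ} {m₁ m₂ c : ℝ}

theorem p_pos (h : CostBounds D p f m₁ m₂ c) : 0 < p := one_pos.trans h.one_lt

theorem nonneg (h : CostBounds D p f m₁ m₂ c) {x : Euc d} (hx : x ∈ D) (v : Euc d) :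
    0 ≤ f x v :=
  (mul_nonneg h.m₁_pos.le (Real.rpow_nonneg (norm_nonneg v) p)).trans (h.lower x hx v)

theorem map_zero (h : CostBounds D p f m₁ m₂ c) {x : Euc d} (hx : x ∈ D) : f x 0 = 0 := by
  apply le_antisymm _ (h.nonneg hx 0)
  simpa [Real.zero_rpow h.p_pos.ne'] using h.upper x hx 0

theorem measurable_comp (h : CostBounds D p f m₁ m₂ c) {y u : ℝ → Euc d} (hy : Measurable y)
    (hu : Measurable u) (hD : ∀ t, y t ∈ D) : Measurable fun t => f (y t) (u t) := by
  have h1 := h.continuousOn.domRestrict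
  have h2 : Measurable fun t => (⟨(y t, u t), ⟨hD t, trivial⟩⟩ : (D ×ˢ univ : Set (Euc d × Euc d))) :=
    (hy.prodMk hu).subtype_mk
  exact h1.measurable.comp h2

theorem le_of_norm_le (h : CostBounds D p f m₁ m₂ c) {x v : Euc d} (hx : x ∈ D) {K : ℝ}
    (hv : ‖v‖ ≤ K) : f x v ≤ m₂ * K ^ p := by
  refine (h.upper x hx v).trans ?_
  have := h.m₂_pos
  have := h.p_pos
  gcongr

theorem intervalIntegrable_comp (h : CostBounds D p f m₁ m₂ c) {y u : ℝ → Euc d}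
    (hy : Measurable y) (hu : Measurable u) (hD : ∀ t, y t ∈ D) {K : ℝ} (hK : ∀ t, ‖u t‖ ≤ K)
    (s t : ℝ) : IntervalIntegrable (fun t => f (y t) (u t)) volume s t := by
  refine (intervalIntegrable_const (c := m₂ * K ^ p)).mono_fun
    (h.measurable_comp hy hu hD).aestronglyMeasurable (Eventually.of_forall fun r => ?_)
  simp only [Real.norm_eq_abs]
  rw [abs_of_nonneg (h.nonneg (hD r) _)]
  exact (h.le_of_norm_le (hD r) (hK r)).trans (le_abs_self _)

theorem continuous_right (h : CostBounds D p f m₁ m₂ c) {x : Euc d} (hx : x ∈ D) :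
    Continuous (f x) := by
  rw [← continuousOn_univ]
  exact h.continuousOn.comp (f := fun v => (x, v)) (by fun_prop) (fun v _ => ⟨hx, trivial⟩)

end CostBounds

/-- Coordinates reduce this to scalar Lipschitz functions, which are absolutely continuous. Almost
everywhere differentiability of `γ` lets the derivative commute with the coordinate projections. -/
theorem _root_.LipschitzWith.intervalIntegral_deriv {d : ℕ} {K : NNReal} {γ : ℝ → Euc d}
    (hγ : LipschitzWith K γ) (s t : ℝ) : ∫ r in s..t, deriv γ r = γ t - γ s := by
  have hint : IntervalIntegrable (deriv γ) volume s t := by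
    refine (intervalIntegrable_const (c := (K : ℝ))).mono_fun
      (measurable_deriv γ).aestronglyMeasurable (Eventually.of_forall fun r => ?_)
    simpa using norm_deriv_le_of_lipschitz hγ
  ext i
  have hc : LipschitzWith K fun r => γ r i := by
    refine LipschitzWith.of_dist_le_mul fun x y => (?_ : _ ≤ dist (γ x) (γ y)).trans
      (hγ.dist_le_mul x y)
    rw [dist_eq_norm, dist_eq_norm]
    exact PiLp.norm_apply_le (γ x - γ y) i
  have h1 := (hc.lipschitzOnWith (s := uIcc s t)).absolutelyContinuousOnInterval.integral_deriv_eq_sub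
  let P : Euc d →L[ℝ] ℝ := EuclideanSpace.proj i
  have h2 : ∫ r in s..t, P (deriv γ r) = P (∫ r in s..t, deriv γ r) :=
    P.intervalIntegral_comp_comm hint
  change P (∫ r in s..t, deriv γ r) = _
  rw [← h2, PiLp.sub_apply, ← h1]
  refine intervalIntegral.integral_congr_ae ?_
  filter_upwards [hγ.ae_differentiableAt_real] with r hr _
  exact (P.hasFDerivAt.comp_hasDerivAt r hr.hasDerivAt).deriv.symm

namespace CostBounds

variable {d : ℕ} {D : Set (Euc d)} {p : ℝ} {f : Euc d → Euc d → ℝ} {m₁ m₂ c : ℝ}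

theorem intervalIntegrable_path (h : CostBounds D p f m₁ m₂ c) {K : NNReal} {γ : ℝ → Euc d}
    (hγ : LipschitzWith K γ) (hD : ∀ t, γ t ∈ D) (s t : ℝ) :
    IntervalIntegrable (fun t => f (γ t) (deriv γ t)) volume s t :=
  h.intervalIntegrable_comp hγ.continuous.measurable (measurable_deriv γ) hD
    (fun _ => norm_deriv_le_of_lipschitz hγ) s t

/-- Jensen's inequality on a short time interval, with the first argument frozen. -/
theorem frozen_le_integral (h : CostBounds D p f m₁ m₂ c) {K : NNReal} {γ : ℝ → Euc d}
    (hγ : LipschitzWith K γ) (hD : ∀ t, γ t ∈ D) {s t : ℝ} (hst : s < t) :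
    (t - s) * f (γ s) ((t - s)⁻¹ • (γ t - γ s)) ≤
      (∫ r in s..t, f (γ r) (deriv γ r)) + c * K ^ (p + 1) * (t - s) ^ 2 := by
  have hts : 0 < t - s := sub_pos.2 hst
  have hb : ∀ r, ‖deriv γ r‖ ≤ K := fun r => norm_deriv_le_of_lipschitz hγ
  have hi1 : IntervalIntegrable (fun r => f (γ s) (deriv γ r)) volume s t :=
    h.intervalIntegrable_comp measurable_const (measurable_deriv γ) (fun _ => hD s) hb s t
  have hi2 := h.intervalIntegrable_path hγ hD s t
  have hi3 : IntervalIntegrable (deriv γ) volume s t := by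
    refine (intervalIntegrable_const (c := (K : ℝ))).mono_fun
      (measurable_deriv γ).aestronglyMeasurable (Eventually.of_forall fun r => ?_)
    simpa using hb r
  have hJ : f (γ s) ((t - s)⁻¹ • (γ t - γ s)) ≤ (t - s)⁻¹ * ∫ r in s..t, f (γ s) (deriv γ r) := by
    have := (h.convex (γ s) (hD s)).map_set_average_le (μ := volume) (t := Ioc s t) (f := deriv γ)
      (h.continuous_right (hD s)).continuousOn isClosed_univ (by simp [hst]) (by simp)
      (by simp) hi3.1 hi1.1
    rw [setAverage_eq, setAverage_eq, ← intervalIntegral.integral_of_le hst.le,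
      ← intervalIntegral.integral_of_le hst.le, hγ.intervalIntegral_deriv] at this
    simpa [Measure.real, ENNReal.toReal_ofReal hts.le] using this
  have hK : (0 : ℝ) ≤ K := K.2
  -- Unfreezing the base point costs at most `c * (K * (t - s)) * K ^ p` at each time, by (Lip) and
  -- the bound `K` on displacement rate and speed.
  have hcmp : ∫ r in s..t, f (γ s) (deriv γ r) ≤
      ∫ r in s..t, (f (γ r) (deriv γ r) + c * K ^ (p + 1) * (t - s)) := by
    refine intervalIntegral.integral_mono_on hst.le hi1 (hi2.add intervalIntegrable_const)
      fun r hr => ?_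
    have h1 := (le_abs_self _).trans (h.lip _ (hD s) _ (hD r) (deriv γ r))
    have h2 : ‖γ s - γ r‖ ≤ K * (t - s) := by
      rw [← dist_eq_norm]
      refine (hγ.dist_le_mul s r).trans ?_
      gcongr
      rw [Real.dist_eq, abs_sub_comm, abs_of_nonneg (sub_nonneg.2 hr.1)]
      linarith [hr.2]
    have h3 : c * ‖γ s - γ r‖ * ‖deriv γ r‖ ^ p ≤ c * (K * (t - s)) * K ^ p := by
      have := h.c_nonneg
      have := h.p_pos
      gcongr
      exact hb r
    have h4 : (K : ℝ) ^ (p + 1) = K ^ p * K := by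
      rw [Real.rpow_add_one' hK (by linarith [h.p_pos])]
    rw [h4]
    linarith
  rw [intervalIntegral.integral_add hi2 intervalIntegrable_const,
    intervalIntegral.integral_const, smul_eq_mul] at hcmp
  have := mul_le_mul_of_nonneg_left hJ hts.le
  rw [← mul_assoc, mul_inv_cancel₀ hts.ne', one_mul] at this
  nlinarith

/-- Each of the `m` intervals of length `1 / m` contributes an error `c K ^ (p + 1) / m ^ 2`. The
error depends on `γ` only through `K`, which is what lower semicontinuity needs. -/
theorem riemannCost_samplePath_le (h : CostBounds D p f m₁ m₂ c) {K : NNReal} {γ : ℝ → Euc d}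
    (hγ : LipschitzWith K γ) (hD : ∀ t, γ t ∈ D) {m : ℕ} (hm : 1 ≤ m) :
    riemannCost f (samplePath γ m) ≤ pathCost f γ + c * K ^ (p + 1) / m := by
  have hm0 : (0 : ℝ) < m := by exact_mod_cast hm
  have hsum : pathCost f γ = ∑ i ∈ Finset.range m,
      ∫ r in ((i : ℝ) / m)..(((i + 1 : ℕ) : ℝ) / m), f (γ r) (deriv γ r) := by
    rw [intervalIntegral.sum_integral_adjacent_intervals (a := fun i : ℕ => (i : ℝ) / m)
      fun i _ => h.intervalIntegrable_path hγ hD _ _]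
    simp [pathCost, div_self hm0.ne']
  have hle : ∀ i ∈ Finset.range m, (1 / (m : ℝ)) * f (γ ((i : ℝ) / m))
      ((m : ℝ) • (γ (((i + 1 : ℕ) : ℝ) / m) - γ ((i : ℝ) / m))) ≤
      (∫ r in ((i : ℝ) / m)..(((i + 1 : ℕ) : ℝ) / m), f (γ r) (deriv γ r)) +
        c * K ^ (p + 1) * (1 / (m : ℝ)) ^ 2 := fun i _ => by
    have hd : ((i + 1 : ℕ) : ℝ) / m - (i : ℝ) / m = 1 / m := by push_cast; ring
    have hlt : (i : ℝ) / m < ((i + 1 : ℕ) : ℝ) / m := by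
      have : (0 : ℝ) < 1 / m := by positivity
      linarith
    have := h.frozen_le_integral hγ hD hlt
    rw [hd] at this
    simpa using this
  have := Finset.sum_le_sum hle
  rw [← Finset.mul_sum, Finset.sum_add_distrib, ← hsum, Finset.sum_const, Finset.card_range,
    nsmul_eq_mul] at this
  refine this.trans (le_of_eq ?_)
  field_simp

end CostBounds
end GeodesicApprox

/-! ### Polygonal paths with arbitrary knots -/

namespace GeodesicApprox

variable {d : ℕ}

theorem pathCost_congr (f : Euc d → Euc d → ℝ) {γ η : ℝ → Euc d} (hγ : EqOn γ η (Icc 0 1)) :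
    pathCost f γ = pathCost f η := by
  refine intervalIntegral.integral_congr_ae ?_
  -- The derivative at `1` sees values outside `[0,1]`, so this null set is discarded.
  have h1 : ∀ᵐ t : ℝ, t ≠ 1 := by simp [ae_iff]
  filter_upwards [h1] with t ht1 ht
  rw [uIoc_of_le zero_le_one] at ht
  have hlt : t < 1 := lt_of_le_of_ne ht.2 ht1
  have : γ =ᶠ[𝓝 t] η := by
    filter_upwards [Ioo_mem_nhds ht.1 hlt] with s hs
    exact hγ ⟨hs.1.le, hs.2.le⟩
  rw [this.eq_of_nhds, this.deriv_eq]

theorem mem_lipPaths {D : Set (Euc d)} {K : NNReal} {γ : ℝ → Euc d} (hγ : LipschitzWith K γ)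
    (hD : ∀ t, γ t ∈ D) : γ ∈ lipPaths D (γ 0) (γ 1) :=
  ⟨⟨K, hγ.lipschitzOnWith⟩, fun t _ => hD t, rfl, rfl⟩

/-- Constant extension beyond `0` and `1` makes the Lipschitz bound and membership in `D` global, so
that no estimate has to track the interval. -/
theorem exists_extension_of_mem_lipPaths {D : Set (Euc d)} {a b : Euc d} {γ : ℝ → Euc d}
    (hγ : γ ∈ lipPaths D a b) : ∃ (K : NNReal) (η : ℝ → Euc d), LipschitzWith K η ∧
      (∀ t, η t ∈ D) ∧ EqOn η γ (Icc 0 1) ∧ η 0 = a ∧ η 1 = b := by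
  obtain ⟨⟨K, hK⟩, hD, h0, h1⟩ := hγ
  have heq : EqOn (IccExtend zero_le_one ((Icc (0 : ℝ) 1).domRestrict γ)) γ (Icc 0 1) :=
    fun t ht => by rw [IccExtend_of_mem _ _ ht]; rfl
  refine ⟨K, IccExtend zero_le_one ((Icc (0 : ℝ) 1).domRestrict γ), ?_, fun t => ?_, heq, ?_, ?_⟩
  · have h2 := hK.to_restrict.comp (LipschitzWith.projIcc (zero_le_one (α := ℝ)))
    rwa [mul_one] at h2
  · exact hD (projIcc 0 1 zero_le_one t).2
  · rw [heq ⟨le_rfl, zero_le_one⟩, h0]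
  · rw [heq ⟨zero_le_one, le_rfl⟩, h1]

theorem exists_mem_Icc_knots {m : ℕ} (hm : 1 ≤ m) (T : ℕ → ℝ) {t : ℝ} (h0 : T 0 ≤ t)
    (h1 : t ≤ T m) : ∃ i < m, t ∈ Icc (T i) (T (i + 1)) := by
  induction m, hm using Nat.le_induction with
  | base => exact ⟨0, one_pos, h0, h1⟩
  | succ n hn ih =>
    rcases le_total t (T n) with h | h
    · obtain ⟨i, hi, hit⟩ := ih h
      exact ⟨i, by omega, hit⟩
    · exact ⟨n, by omega, h, h1⟩

/-- The polygonal path which visits `v i` at time `T i`, for `i ≤ m`. -/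
noncomputable def polygon (m : ℕ) (T : ℕ → ℝ) (v : ℕ → Euc d) (t : ℝ) : Euc d :=
  v 0 + ∑ i ∈ Finset.range m,
    ((min t (T (i + 1)) - min t (T i)) / (T (i + 1) - T i)) • (v (i + 1) - v i)

variable {m : ℕ} {T : ℕ → ℝ}

theorem polygon_eq (hT : StrictMonoOn T (Iic m)) (v : ℕ → Euc d) {i : ℕ} (hi : i < m) {t : ℝ}
    (ht : t ∈ Icc (T i) (T (i + 1))) :
    polygon m T v t = v i + ((t - T i) / (T (i + 1) - T i)) • (v (i + 1) - v i) := by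
  have hlo : ∑ j ∈ Finset.range i,
      ((min t (T (j + 1)) - min t (T j)) / (T (j + 1) - T j)) • (v (j + 1) - v j) = v i - v 0 := by
    rw [← Finset.sum_range_sub]
    refine Finset.sum_congr rfl fun j hj => ?_
    rw [Finset.mem_range] at hj
    have h1 : T j < T (j + 1) := hT (mem_Iic.2 (by omega)) (mem_Iic.2 (by omega)) (by omega)
    have h2 : T (j + 1) ≤ T i := hT.monotoneOn (mem_Iic.2 (by omega)) (mem_Iic.2 (by omega)) hj
    have h3 := ht.1
    rw [min_eq_right (by linarith), min_eq_right (by linarith), div_self (by linarith), one_smul]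
  have hhi : ∑ j ∈ Finset.Ico (i + 1) m,
      ((min t (T (j + 1)) - min t (T j)) / (T (j + 1) - T j)) • (v (j + 1) - v j) = 0 := by
    refine Finset.sum_eq_zero fun j hj => ?_
    rw [Finset.mem_Ico] at hj
    have h1 : T j < T (j + 1) := hT (mem_Iic.2 (by omega)) (mem_Iic.2 (by omega)) (by omega)
    have h2 : T (i + 1) ≤ T j := hT.monotoneOn (mem_Iic.2 (by omega)) (mem_Iic.2 (by omega)) hj.1
    have h3 := ht.2
    rw [min_eq_left (by linarith), min_eq_left (by linarith), sub_self, zero_div, zero_smul]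
  rw [polygon, ← Finset.sum_range_add_sum_Ico _ (show i + 1 ≤ m from hi), hhi,
    Finset.sum_range_succ, hlo, min_eq_left ht.2, min_eq_right ht.1]
  abel

/-- Between times `s` and `t`, edge `i` contributes at most `K` times the time spent in `[T i, T (i
+ 1)]`, and these durations telescope. -/
theorem lipschitzWith_polygon (hT : StrictMonoOn T (Iic m)) {v : ℕ → Euc d} {K : NNReal}
    (hK : ∀ i < m, ‖v (i + 1) - v i‖ ≤ K * (T (i + 1) - T i)) :
    LipschitzWith K (polygon m T v) := by
  have key : ∀ s t, s ≤ t → dist (polygon m T v t) (polygon m T v s) ≤ K * (t - s) := by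
    intro s t hst
    have hle : ∀ i ∈ Finset.range m,
        ‖((min t (T (i + 1)) - min t (T i)) / (T (i + 1) - T i)) • (v (i + 1) - v i) -
          ((min s (T (i + 1)) - min s (T i)) / (T (i + 1) - T i)) • (v (i + 1) - v i)‖ ≤
        K * ((min t (T (i + 1)) - min s (T (i + 1))) - (min t (T i) - min s (T i))) := by
      intro i hi
      rw [Finset.mem_range] at hi
      have h1 : 0 < T (i + 1) - T i :=
        sub_pos.2 (hT (mem_Iic.2 (by omega)) (mem_Iic.2 (by omega)) (by omega))
      have h2 : 0 ≤ (min t (T (i + 1)) - min s (T (i + 1))) - (min t (T i) - min s (T i)) := by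
        rcases le_total t (T (i + 1)) with h | h <;> rcases le_total t (T i) with h' | h' <;>
        rcases le_total s (T (i + 1)) with h'' | h'' <;> rcases le_total s (T i) with h3 | h3 <;>
        simp only [min_eq_left, min_eq_right, h, h', h'', h3] <;> linarith
      rw [← sub_smul, norm_smul, Real.norm_eq_abs, ← sub_div, abs_div, abs_of_pos h1,
        abs_of_nonneg (by linarith), div_mul_eq_mul_div, div_le_iff₀ h1]
      have := mul_le_mul_of_nonneg_left (hK i hi) h2
      linarith
    rw [dist_eq_norm, polygon, polygon, add_sub_add_left_eq_sub, ← Finset.sum_sub_distrib]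
    refine (norm_sum_le_of_le _ hle).trans ?_
    rw [← Finset.mul_sum, Finset.sum_range_sub (fun i => min t (T i) - min s (T i))]
    have h3 : min t (T m) - min s (T m) ≤ t - s := by
      rcases le_total t (T m) with h | h <;> rcases le_total s (T m) with h' | h' <;>
        simp only [min_eq_left, min_eq_right, h, h'] <;> linarith
    have h4 : min s (T 0) ≤ min t (T 0) := min_le_min_right _ hst
    have h5 : (0 : ℝ) ≤ K := K.2
    exact mul_le_mul_of_nonneg_left (by linarith) h5
  refine LipschitzWith.of_dist_le_mul fun s t => ?_
  rcases le_total s t with hst | hst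
  · rw [dist_comm, dist_comm s t, Real.dist_eq, abs_of_nonneg (sub_nonneg.2 hst)]
    exact key s t hst
  · rw [Real.dist_eq, abs_of_nonneg (sub_nonneg.2 hst)]
    exact key t s hst

theorem polygon_knot (hm : 1 ≤ m) (hT : StrictMonoOn T (Iic m)) (v : ℕ → Euc d) {i : ℕ}
    (hi : i ≤ m) : polygon m T v (T i) = v i := by
  rcases hi.lt_or_eq with h | rfl
  · have h1 : T i < T (i + 1) := hT (mem_Iic.2 (by omega)) (mem_Iic.2 (by omega)) (by omega)
    rw [polygon_eq hT v h ⟨le_rfl, h1.le⟩]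
    simp
  · obtain ⟨j, rfl⟩ : ∃ j, i = j + 1 := ⟨i - 1, by omega⟩
    have h1 : T j < T (j + 1) := hT (mem_Iic.2 (by omega)) (mem_Iic.2 (by omega)) (by omega)
    rw [polygon_eq hT v (Nat.lt_succ_self j) ⟨h1.le, le_rfl⟩, div_self (by linarith)]
    simp

theorem polygon_mem {D : Set (Euc d)} (hD : Convex ℝ D) (hm : 1 ≤ m)
    (hT : StrictMonoOn T (Iic m)) {v : ℕ → Euc d} (hv : ∀ i ≤ m, v i ∈ D) (t : ℝ) :
    polygon m T v t ∈ D := by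
  have hmono : ∀ i ≤ m, T 0 ≤ T i ∧ T i ≤ T m := fun i hi =>
    ⟨hT.monotoneOn (mem_Iic.2 (by omega)) (mem_Iic.2 hi) (by omega),
      hT.monotoneOn (mem_Iic.2 hi) (mem_Iic.2 le_rfl) hi⟩
  -- The polygon is constant outside `[T 0, T m]`, so only times inside need be considered.
  have hclamp : polygon m T v t = polygon m T v (max (T 0) (min t (T m))) := by
    unfold polygon
    congr 1
    refine Finset.sum_congr rfl fun i hi => ?_
    rw [Finset.mem_range] at hi
    have h1 := hmono i hi.le
    have h2 := hmono (i + 1) hi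
    congr 2
    rcases le_total t (T m) with h | h
    · rw [min_eq_left h]
      rcases le_total t (T 0) with h' | h'
      · rw [max_eq_left h', min_eq_left (h'.trans h2.1), min_eq_left (h'.trans h1.1),
          min_eq_left h2.1, min_eq_left h1.1, sub_self, sub_self]
      · rw [max_eq_right h']
    · rw [min_eq_right h, max_eq_right (h1.1.trans h1.2), min_eq_right (h2.2.trans h),
        min_eq_right (h1.2.trans h), min_eq_right h2.2, min_eq_right h1.2]
  rw [hclamp]
  obtain ⟨i, hi, hit⟩ := exists_mem_Icc_knots hm T (t := max (T 0) (min t (T m)))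
    (le_max_left _ _) (max_le (hmono m le_rfl).1 (min_le_right _ _))
  have h1 : 0 < T (i + 1) - T i :=
    sub_pos.2 (hT (mem_Iic.2 (by omega)) (mem_Iic.2 (by omega)) (by omega))
  rw [polygon_eq hT v hi hit]
  refine hD.add_smul_sub_mem (hv i hi.le) (hv (i + 1) hi) ⟨?_, ?_⟩
  · exact div_nonneg (sub_nonneg.2 hit.1) h1.le
  · rw [div_le_one h1]
    linarith [hit.2]

theorem deriv_polygon (hT : StrictMonoOn T (Iic m)) (v : ℕ → Euc d) {i : ℕ} (hi : i < m) {t : ℝ}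
    (ht : t ∈ Ioo (T i) (T (i + 1))) :
    deriv (polygon m T v) t = (T (i + 1) - T i)⁻¹ • (v (i + 1) - v i) := by
  have h1 : polygon m T v =ᶠ[𝓝 t]
      fun s => v i + ((s - T i) / (T (i + 1) - T i)) • (v (i + 1) - v i) := by
    filter_upwards [Ioo_mem_nhds ht.1 ht.2] with s hs
    exact polygon_eq hT v hi ⟨hs.1.le, hs.2.le⟩
  rw [h1.deriv_eq]
  have h2 : HasDerivAt (fun s : ℝ => (s - T i) / (T (i + 1) - T i)) (1 / (T (i + 1) - T i)) t :=
    ((hasDerivAt_id t).sub_const _).div_const _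
  rw [((h2.smul_const (v (i + 1) - v i)).const_add (v i)).deriv, one_div]

theorem linInterp_eqOn_polygon (v : DiscretePath d) (hm : 1 ≤ v.steps) :
    EqOn (linInterp v) (polygon v.steps (fun i => (i : ℝ) / v.steps) v.vertex) (Icc 0 1) := by
  have hm0 : (0 : ℝ) < v.steps := by exact_mod_cast hm
  have hT : StrictMonoOn (fun i : ℕ => (i : ℝ) / v.steps) (Iic v.steps) := fun i _ j _ hij => by
    have : (i : ℝ) < j := by exact_mod_cast hij
    dsimp only
    gcongr
  intro t ht
  obtain ⟨i, hi, hit⟩ := exists_mem_Icc_knots hm (fun i : ℕ => (i : ℝ) / v.steps) (t := t)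
    (by simpa using ht.1) (by simpa [div_self hm0.ne'] using ht.2)
  rw [polygon_eq hT v.vertex hi hit, linInterp_eq v i hi t hit.1 (by simpa using hit.2)]
  have h1 : (t - (i : ℝ) / v.steps) / (((i + 1 : ℕ) : ℝ) / v.steps - (i : ℝ) / v.steps) =
      v.steps * t - i := by
    have : ((i + 1 : ℕ) : ℝ) / v.steps - (i : ℝ) / v.steps = 1 / v.steps := by push_cast; ring
    rw [this]
    field_simp
  rw [h1]
  module

/-- The cost of a polygonal path is close to the cost with the first argument frozen at the
initial vertex of each edge. -/
theorem CostBounds.abs_pathCost_polygon_sub_le {D : Set (Euc d)} {p : ℝ}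
    {f : Euc d → Euc d → ℝ} {m₁ m₂ c : ℝ} (h : CostBounds D p f m₁ m₂ c) (hm : 1 ≤ m)
    (hT : StrictMonoOn T (Iic m)) (hT0 : T 0 = 0) (hT1 : T m = 1) {v : ℕ → Euc d}
    (hv : ∀ i ≤ m, v i ∈ D) {K : NNReal}
    (hK : ∀ i < m, ‖v (i + 1) - v i‖ ≤ K * (T (i + 1) - T i)) {δ : ℝ}
    (hδ : ∀ i < m, ‖v (i + 1) - v i‖ ≤ δ) :
    |pathCost f (polygon m T v) - ∑ i ∈ Finset.range m,
        (T (i + 1) - T i) * f (v i) ((T (i + 1) - T i)⁻¹ • (v (i + 1) - v i))| ≤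
      c * δ / m₁ * ∑ i ∈ Finset.range m,
        (T (i + 1) - T i) * f (v i) ((T (i + 1) - T i)⁻¹ • (v (i + 1) - v i)) := by
  have hlip := lipschitzWith_polygon hT hK
  have hmem := polygon_mem h.convexDomain hm hT hv
  have hsum : pathCost f (polygon m T v) = ∑ i ∈ Finset.range m,
      ∫ r in (T i)..(T (i + 1)), f (polygon m T v r) (deriv (polygon m T v) r) := by
    rw [intervalIntegral.sum_integral_adjacent_intervals
      fun i _ => h.intervalIntegrable_path hlip hmem _ _, hT0, hT1, pathCost]
  rw [hsum, ← Finset.sum_sub_distrib, Finset.mul_sum]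
  refine (Finset.abs_sum_le_sum_abs _ _).trans (Finset.sum_le_sum fun i hi => ?_)
  rw [Finset.mem_range] at hi
  have hτ : 0 < T (i + 1) - T i :=
    sub_pos.2 (hT (mem_Iic.2 (by omega)) (mem_Iic.2 (by omega)) (by omega))
  set u := (T (i + 1) - T i)⁻¹ • (v (i + 1) - v i) with hu
  have hconst : (T (i + 1) - T i) * f (v i) u = ∫ _ in (T i)..(T (i + 1)), f (v i) u := by
    rw [intervalIntegral.integral_const, smul_eq_mul]
  rw [hconst, ← intervalIntegral.integral_sub (h.intervalIntegrable_path hlip hmem _ _)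
    intervalIntegrable_const]
  have h1 : ∀ᵐ t : ℝ, t ≠ T (i + 1) := by simp [ae_iff]
  have hb : ∀ᵐ t : ℝ, t ∈ uIoc (T i) (T (i + 1)) →
      ‖f (polygon m T v t) (deriv (polygon m T v) t) - f (v i) u‖ ≤ c * δ / m₁ * f (v i) u := by
    filter_upwards [h1] with t ht1 ht
    rw [uIoc_of_le (sub_pos.1 hτ).le] at ht
    rw [deriv_polygon hT v hi ⟨ht.1, lt_of_le_of_ne ht.2 ht1⟩, Real.norm_eq_abs]
    refine (h.lip _ (hmem t) _ (hv i hi.le) _).trans ?_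
    have h2 : ‖polygon m T v t - v i‖ ≤ δ := by
      rw [polygon_eq hT v hi ⟨ht.1.le, ht.2⟩, add_sub_cancel_left, norm_smul, Real.norm_eq_abs,
        abs_of_nonneg (div_nonneg (by linarith [ht.1]) hτ.le)]
      refine (mul_le_of_le_one_left (norm_nonneg _) ?_).trans (hδ i hi)
      rw [div_le_one hτ]
      linarith [ht.2]
    -- The lower growth bound turns the (Lip) error `c δ ‖u‖ ^ p` into an error relative to the cost
    -- itself, so no speed bound enters.
    have h3 : ‖u‖ ^ p ≤ f (v i) u / m₁ := by
      rw [le_div_iff₀' h.m₁_pos]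
      exact h.lower _ (hv i hi.le) u
    have h4 := h.c_nonneg
    have h5 : 0 ≤ δ := (norm_nonneg _).trans h2
    calc c * ‖polygon m T v t - v i‖ * ‖u‖ ^ p ≤ c * δ * (f (v i) u / m₁) := by gcongr
      _ = c * δ / m₁ * f (v i) u := by ring
  have := intervalIntegral.norm_integral_le_of_norm_le_const_ae hb
  rw [Real.norm_eq_abs, abs_of_pos hτ] at this
  rw [intervalIntegral.integral_const, smul_eq_mul]
  linarith

end GeodesicApprox

/-! ### Riemann sums, lower semicontinuity and compactness -/

namespace GeodesicApprox

variable {d : ℕ}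

theorem strictMonoOn_uniform_knots {m : ℕ} (hm : 1 ≤ m) :
    StrictMonoOn (fun i : ℕ => (i : ℝ) / m) (Iic m) := fun i _ j _ hij => by
  have hm0 : (0 : ℝ) < m := by exact_mod_cast hm
  have : (i : ℝ) < j := by exact_mod_cast hij
  dsimp only
  gcongr

theorem uniform_knots_sub (m i : ℕ) : ((i + 1 : ℕ) : ℝ) / m - (i : ℝ) / m = 1 / m := by
  push_cast; ring

theorem exists_lipschitz_polygon (v : DiscretePath d) (hm : 1 ≤ v.steps) :
    ∃ K : NNReal, ∀ i < v.steps, ‖v.vertex (i + 1) - v.vertex i‖ ≤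
      K * (((i + 1 : ℕ) : ℝ) / v.steps - (i : ℝ) / v.steps) := by
  have hm0 : (0 : ℝ) < v.steps := by exact_mod_cast hm
  refine ⟨v.steps * ∑ i ∈ Finset.range v.steps, ‖v.vertex (i + 1) - v.vertex i‖₊, fun i hi => ?_⟩
  rw [uniform_knots_sub]
  push_cast
  rw [mul_comm, ← mul_assoc, one_div, inv_mul_cancel₀ hm0.ne', one_mul]
  exact Finset.single_le_sum (f := fun i => ‖v.vertex (i + 1) - v.vertex i‖)
    (fun _ _ => norm_nonneg _) (Finset.mem_range.2 hi)

theorem linInterp_mem_lipPaths {D : Set (Euc d)} (hD : Convex ℝ D) {v : DiscretePath d}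
    (hm : 1 ≤ v.steps) (hv : ∀ i ≤ v.steps, v.vertex i ∈ D) :
    linInterp v ∈ lipPaths D (v.vertex 0) (v.vertex v.steps) := by
  obtain ⟨K, hK⟩ := exists_lipschitz_polygon v hm
  have heq := linInterp_eqOn_polygon v hm
  refine ⟨⟨K, fun s hs t ht => ?_⟩, fun t ht => ?_, ?_, ?_⟩
  · rw [heq hs, heq ht]
    exact lipschitzWith_polygon (strictMonoOn_uniform_knots hm) hK s t
  · rw [heq ht]
    exact polygon_mem hD hm (strictMonoOn_uniform_knots hm) hv t
  · simp [linInterp]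
  · simp [linInterp]

theorem CostBounds.abs_pathCost_linInterp_sub_le {D : Set (Euc d)} {p : ℝ}
    {f : Euc d → Euc d → ℝ} {m₁ m₂ c : ℝ} (h : CostBounds D p f m₁ m₂ c) {v : DiscretePath d}
    (hm : 1 ≤ v.steps) (hv : ∀ i ≤ v.steps, v.vertex i ∈ D) {δ : ℝ}
    (hδ : ∀ i < v.steps, ‖v.vertex (i + 1) - v.vertex i‖ ≤ δ) :
    |pathCost f (linInterp v) - riemannCost f v| ≤ c * δ / m₁ * riemannCost f v := by
  have hm0 : (0 : ℝ) < v.steps := by exact_mod_cast hm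
  obtain ⟨K, hK⟩ := exists_lipschitz_polygon v hm
  have := h.abs_pathCost_polygon_sub_le hm (strictMonoOn_uniform_knots hm) (by simp)
    (by simp [div_self hm0.ne']) hv hK hδ
  rw [← pathCost_congr f (linInterp_eqOn_polygon v hm)] at this
  simp only [uniform_knots_sub, ← Finset.mul_sum] at this
  simpa [riemannCost] using this

/-- Because `u n ≤ t ≤ w n`, the first-order errors at the two endpoints are small relative to `t -
u n` and `w n - t`, which add up to the denominator `w n - u n`. -/
theorem _root_.HasDerivAt.tendsto_straddle {γ : ℝ → Euc d} {γ' : Euc d} {t : ℝ}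
    (hγ : HasDerivAt γ γ' t) {u w : ℕ → ℝ} (hu : Tendsto u atTop (𝓝 t))
    (hw : Tendsto w atTop (𝓝 t)) (hut : ∀ᶠ n in atTop, u n ≤ t) (hwt : ∀ᶠ n in atTop, t ≤ w n)
    (huw : ∀ᶠ n in atTop, u n < w n) :
    Tendsto (fun n => (w n - u n)⁻¹ • (γ (w n) - γ (u n))) atTop (𝓝 γ') := by
  rw [Metric.tendsto_nhds]
  intro e he
  have h1 := (hasDerivAt_iff_isLittleO.1 hγ).def (half_pos he)
  filter_upwards [hu.eventually h1, hw.eventually h1, hut, hwt, huw] with n h2 h3 h4 h5 h6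
  have h7 : 0 < w n - u n := sub_pos.2 h6
  rw [Real.norm_eq_abs, abs_of_nonpos (by linarith)] at h2
  rw [Real.norm_eq_abs, abs_of_nonneg (by linarith)] at h3
  have h8 : ‖(γ (w n) - γ (u n)) - (w n - u n) • γ'‖ ≤ e / 2 * (w n - u n) := by
    calc ‖(γ (w n) - γ (u n)) - (w n - u n) • γ'‖
        = ‖(γ (w n) - γ t - (w n - t) • γ') - (γ (u n) - γ t - (u n - t) • γ')‖ := by
          congr 1; module
      _ ≤ _ := (norm_sub_le _ _).trans (add_le_add h3 h2)
      _ = _ := by ring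
  have h9 : (w n - u n)⁻¹ • (γ (w n) - γ (u n)) - γ' =
      (w n - u n)⁻¹ • ((γ (w n) - γ (u n)) - (w n - u n) • γ') := by
    rw [smul_sub _ (γ (w n) - γ (u n)), inv_smul_smul₀ h7.ne']
  rw [dist_eq_norm, h9, norm_smul, Real.norm_eq_abs, abs_of_pos (inv_pos.2 h7)]
  calc (w n - u n)⁻¹ * _ ≤ (w n - u n)⁻¹ * (e / 2 * (w n - u n)) := by gcongr
    _ = e / 2 := by field_simp
    _ < e := half_lt_self he

namespace CostBounds

variable {D : Set (Euc d)} {p : ℝ} {f : Euc d → Euc d → ℝ} {m₁ m₂ c : ℝ}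

theorem tendsto_comp (h : CostBounds D p f m₁ m₂ c) {ι : Type*} {l : Filter ι} {y u : ι → Euc d}
    {x v : Euc d} (hy : Tendsto y l (𝓝 x)) (hu : Tendsto u l (𝓝 v)) (hyD : ∀ i, y i ∈ D)
    (hx : x ∈ D) : Tendsto (fun i => f (y i) (u i)) l (𝓝 (f x v)) := by
  have h1 := h.continuousOn (x, v) ⟨hx, trivial⟩
  refine h1.tendsto.comp (tendsto_nhdsWithin_iff.2 ⟨hy.prodMk_nhds hu, ?_⟩)
  exact Eventually.of_forall fun i => ⟨hyD i, trivial⟩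

/-- The interpolants of the samples are uniformly Lipschitz and their slopes converge to `deriv γ`
almost everywhere, so their path costs converge by dominated convergence. Each Riemann sum differs
from the cost of its interpolant by `O(1 / m)`. -/
theorem tendsto_riemannCost_samplePath (h : CostBounds D p f m₁ m₂ c) {K : NNReal}
    {γ : ℝ → Euc d} (hγ : LipschitzWith K γ) (hD : ∀ t, γ t ∈ D) :
    Tendsto (fun m => riemannCost f (samplePath γ m)) atTop (𝓝 (pathCost f γ)) := by
  set P : ℕ → ℝ → Euc d :=
    fun m => polygon m (fun i => (i : ℝ) / m) (samplePath γ m).vertex with hP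
  have hstep : ∀ m i : ℕ, ‖(samplePath γ m).vertex (i + 1) - (samplePath γ m).vertex i‖ ≤
      K * (((i + 1 : ℕ) : ℝ) / m - (i : ℝ) / m) := fun m i => by
    rw [← dist_eq_norm]
    refine (hγ.dist_le_mul _ _).trans (le_of_eq ?_)
    rw [Real.dist_eq, abs_of_nonneg]
    rw [uniform_knots_sub]; positivity
  have hPlip : ∀ m, 1 ≤ m → LipschitzWith K (P m) := fun m hm =>
    lipschitzWith_polygon (strictMonoOn_uniform_knots hm) fun i _ => hstep m i
  have hPD : ∀ m, 1 ≤ m → ∀ t, P m t ∈ D := fun m hm t =>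
    polygon_mem h.convexDomain hm (strictMonoOn_uniform_knots hm) (fun i _ => hD _) t
  have hPcost : Tendsto (fun m => pathCost f (P m)) atTop (𝓝 (pathCost f γ)) := by
    refine intervalIntegral.tendsto_integral_filter_of_dominated_convergence
      (fun _ => m₂ * (K : ℝ) ^ p) ?_ ?_ intervalIntegrable_const ?_
    · filter_upwards [eventually_ge_atTop 1] with m hm
      exact (h.measurable_comp (hPlip m hm).continuous.measurable (measurable_deriv _)
        (hPD m hm)).aestronglyMeasurable
    · filter_upwards [eventually_ge_atTop 1] with m hm
      refine Eventually.of_forall fun t _ => ?_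
      rw [Real.norm_eq_abs, abs_of_nonneg (h.nonneg (hPD m hm t) _)]
      exact h.le_of_norm_le (hPD m hm t) (norm_deriv_le_of_lipschitz (hPlip m hm))
    -- An irrational time is never a knot `i / m`, hence lies in the interior of an edge for every
    -- `m ≥ 1`.
    · have hirr : ∀ᵐ t : ℝ, Irrational t := by
        have := (Set.countable_range ((↑) : ℚ → ℝ)).ae_notMem volume
        exact this
      filter_upwards [hγ.ae_differentiableAt_real, hirr] with t htd hti ht
      rw [uIoc_of_le zero_le_one] at ht
      have hex : ∀ m : ℕ, ∃ i : ℕ, 1 ≤ m → i < m ∧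
          t ∈ Ioo ((i : ℝ) / m) (((i + 1 : ℕ) : ℝ) / m) := fun m => by
        by_cases hm : 1 ≤ m
        · have hm0 : (0 : ℝ) < m := by exact_mod_cast hm
          obtain ⟨i, hi, hit⟩ := exists_mem_Icc_knots hm (fun i : ℕ => (i : ℝ) / m) (t := t)
            (by simpa using ht.1.le) (by simpa [div_self hm0.ne'] using ht.2)
          refine ⟨i, fun _ => ⟨hi, lt_of_le_of_ne hit.1 fun h' => hti ⟨(i : ℚ) / m, ?_⟩,
            lt_of_le_of_ne hit.2 fun h' => hti ⟨((i + 1 : ℕ) : ℚ) / m, ?_⟩⟩⟩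
          · rw [← h']; push_cast; rfl
          · rw [h']; push_cast; rfl
        · exact ⟨0, fun h' => absurd h' hm⟩
      choose i hi using hex
      have hinv : Tendsto (fun m : ℕ => 1 / (m : ℝ)) atTop (𝓝 0) :=
        tendsto_one_div_atTop_nhds_zero_nat
      have hu : Tendsto (fun m : ℕ => (i m : ℝ) / m) atTop (𝓝 t) := by
        refine tendsto_of_tendsto_of_tendsto_of_le_of_le' (g := fun m : ℕ => t - 1 / (m : ℝ))
          (by simpa using tendsto_const_nhds.sub hinv) tendsto_const_nhds ?_ ?_
        · filter_upwards [eventually_ge_atTop 1] with m hm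
          have := uniform_knots_sub m (i m)
          linarith [(hi m hm).2.2]
        · filter_upwards [eventually_ge_atTop 1] with m hm
          exact (hi m hm).2.1.le
      have hw : Tendsto (fun m : ℕ => ((i m + 1 : ℕ) : ℝ) / m) atTop (𝓝 t) := by
        have := hu.add hinv
        rw [add_zero] at this
        refine this.congr fun m => ?_
        rw [← uniform_knots_sub m (i m)]; ring
      have hder : Tendsto (fun m => deriv (P m) t) atTop (𝓝 (deriv γ t)) := by
        have := htd.hasDerivAt.tendsto_straddle hu hw
          (by filter_upwards [eventually_ge_atTop 1] with m hm using (hi m hm).2.1.le)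
          (by filter_upwards [eventually_ge_atTop 1] with m hm using (hi m hm).2.2.le)
          (by filter_upwards [eventually_ge_atTop 1] with m hm using
            (hi m hm).2.1.trans (hi m hm).2.2)
        refine this.congr' ?_
        filter_upwards [eventually_ge_atTop 1] with m hm
        exact (deriv_polygon (strictMonoOn_uniform_knots hm) (samplePath γ m).vertex
          (hi m hm).1 (hi m hm).2).symm
      have hval : Tendsto (fun m => P m t) atTop (𝓝 (γ t)) := by
        rw [tendsto_iff_dist_tendsto_zero]
        refine squeeze_zero' (g := fun m : ℕ => 2 * K * (1 / (m : ℝ)))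
          (Eventually.of_forall fun _ => dist_nonneg) ?_
          (by simpa using hinv.const_mul (2 * (K : ℝ)))
        filter_upwards [eventually_ge_atTop 1] with m hm
        have h1 : P m ((i m : ℝ) / m) = γ ((i m : ℝ) / m) :=
          polygon_knot hm (strictMonoOn_uniform_knots hm) _ (hi m hm).1.le
        have h2 := (hPlip m hm).dist_le_mul t ((i m : ℝ) / m)
        have h3 := hγ.dist_le_mul ((i m : ℝ) / m) t
        have h4 : dist t ((i m : ℝ) / m) ≤ 1 / m := by
          rw [Real.dist_eq, abs_of_nonneg (sub_nonneg.2 (hi m hm).2.1.le),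
            ← uniform_knots_sub m (i m)]
          linarith [(hi m hm).2.2]
        have h5 : (0 : ℝ) ≤ K := K.2
        rw [dist_comm _ t] at h3
        have h6 := mul_le_mul_of_nonneg_left h4 h5
        have h7 := dist_triangle (P m t) (P m ((i m : ℝ) / m)) (γ t)
        rw [h1] at h7 h2
        linarith
      -- The shift by one is there because `hPD` needs `1 ≤ m`, while `tendsto_comp` asks for
      -- membership in `D` at every index.
      have := h.tendsto_comp (hval.comp (tendsto_add_atTop_nat 1))
        (hder.comp (tendsto_add_atTop_nat 1)) (fun m => hPD (m + 1) (by omega) t) (hD t)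
      exact (tendsto_add_atTop_iff_nat (f := fun m => f (P m t) (deriv (P m) t)) 1).1 this
  have hbound : ∀ m : ℕ, 1 ≤ m → riemannCost f (samplePath γ m) ≤ m₂ * (K : ℝ) ^ p := by
    intro m hm
    have hm0 : (0 : ℝ) < m := by exact_mod_cast hm
    have h1 : ∀ i ∈ Finset.range m, f ((samplePath γ m).vertex i)
        ((m : ℝ) • ((samplePath γ m).vertex (i + 1) - (samplePath γ m).vertex i)) ≤
        m₂ * (K : ℝ) ^ p := fun i _ => by
      refine h.le_of_norm_le (hD _) ?_
      rw [norm_smul, Real.norm_natCast]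
      have := hstep m i
      rw [uniform_knots_sub] at this
      calc (m : ℝ) * _ ≤ m * (K * (1 / m)) := by gcongr
        _ = K := by field_simp
    have h2 := Finset.sum_le_card_nsmul _ _ _ h1
    rw [Finset.card_range, nsmul_eq_mul] at h2
    calc riemannCost f (samplePath γ m) ≤ 1 / (m : ℝ) * (m * (m₂ * (K : ℝ) ^ p)) := by
          unfold riemannCost
          exact mul_le_mul_of_nonneg_left h2 (by positivity)
      _ = _ := by field_simp
  have hdiff : Tendsto (fun m => pathCost f (P m) - riemannCost f (samplePath γ m)) atTop
      (𝓝 0) := by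
    have hlim := (tendsto_one_div_atTop_nhds_zero_nat (𝕜 := ℝ)).const_mul
      (c * K / m₁ * (m₂ * (K : ℝ) ^ p))
    rw [mul_zero] at hlim
    refine squeeze_zero_norm' (a := fun m : ℕ => c * K / m₁ * (m₂ * (K : ℝ) ^ p) * (1 / (m : ℝ)))
      ?_ hlim
    filter_upwards [eventually_ge_atTop 1] with m hm
    have h1 := h.abs_pathCost_linInterp_sub_le (v := samplePath γ m) hm (fun i _ => hD _)
      (δ := K * (1 / m)) (fun i _ => (hstep m i).trans_eq (by rw [uniform_knots_sub]))
    rw [pathCost_congr f (linInterp_eqOn_polygon (samplePath γ m) hm)] at h1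
    refine h1.trans ?_
    have h2 := hbound m hm
    have h3 := h.c_nonneg
    have h4 := h.m₁_pos
    have h5 : (0 : ℝ) ≤ K := K.2
    calc _ ≤ c * (K * (1 / m)) / m₁ * (m₂ * (K : ℝ) ^ p) := by gcongr
      _ = _ := by ring
  simpa using hPcost.sub hdiff

/-- Lower semicontinuity of the path cost along uniformly Lipschitz sequences. -/
theorem pathCost_le_of_tendsto (h : CostBounds D p f m₁ m₂ c) {K : NNReal} {η : ℕ → ℝ → Euc d}
    (hη : ∀ n, LipschitzWith K (η n)) (hηD : ∀ n t, η n t ∈ D) {γ : ℝ → Euc d}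
    (hγ : LipschitzWith K γ) (hγD : ∀ t, γ t ∈ D)
    (hlim : ∀ t ∈ Icc (0 : ℝ) 1, Tendsto (fun n => η n t) atTop (𝓝 (γ t))) {M : ℝ}
    (hM : Tendsto (fun n => pathCost f (η n)) atTop (𝓝 M)) : pathCost f γ ≤ M := by
  -- For fixed `m` the Riemann sum reads finitely many values of the path, so pointwise convergence
  -- suffices as `n → ∞`. The Jensen error is uniform in `n` and vanishes as `m → ∞` afterwards.
  have hm : ∀ m : ℕ, 1 ≤ m →
      riemannCost f (samplePath γ m) ≤ M + c * (K : ℝ) ^ (p + 1) / m := by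
    intro m hm
    have hm0 : (0 : ℝ) < m := by exact_mod_cast hm
    have hmem : ∀ i ≤ m, (i : ℝ) / m ∈ Icc (0 : ℝ) 1 := fun i hi =>
      ⟨by positivity, by rw [div_le_one hm0]; exact_mod_cast hi⟩
    have h1 : Tendsto (fun n => riemannCost f (samplePath (η n) m)) atTop
        (𝓝 (riemannCost f (samplePath γ m))) := by
      unfold riemannCost
      refine (tendsto_finsetSum _ fun i hi => ?_).const_mul _
      have hi' : i < m := Finset.mem_range.1 hi
      exact h.tendsto_comp (hlim _ (hmem i hi'.le))
        (((hlim _ (hmem (i + 1) hi')).sub (hlim _ (hmem i hi'.le))).const_smul _)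
        (fun n => hηD n _) (hγD _)
    exact le_of_tendsto_of_tendsto' h1 (hM.add_const _)
      fun n => h.riemannCost_samplePath_le (hη n) (hηD n) hm
  have h2 : Tendsto (fun m : ℕ => M + c * (K : ℝ) ^ (p + 1) / m) atTop (𝓝 (M + 0)) :=
    tendsto_const_nhds.add (tendsto_const_div_atTop_nhds_zero_nat _)
  rw [add_zero] at h2
  exact le_of_tendsto_of_tendsto (h.tendsto_riemannCost_samplePath hγ hγD) h2
    (by filter_upwards [eventually_ge_atTop 1] with m using hm m)

end CostBounds

open BoundedContinuousFunction in
theorem exists_subseq_tendstoUniformlyOn {D : Set (Euc d)} (hD : IsCompact D) {K : NNReal}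
    {η : ℕ → ℝ → Euc d} (hη : ∀ n, LipschitzWith K (η n)) (hηD : ∀ n t, η n t ∈ D) :
    ∃ ψ : ℕ → ℕ, StrictMono ψ ∧ ∃ γ : ℝ → Euc d, LipschitzWith K γ ∧ (∀ t, γ t ∈ D) ∧
      TendstoUniformlyOn (fun k => η (ψ k)) γ atTop (Icc 0 1) := by
  let A : Set (Icc (0 : ℝ) 1 →ᵇ Euc d) := {g | LipschitzWith K g ∧ ∀ t, g t ∈ D}
  have hA : IsCompact A := by
    refine arzela_ascoli₂ D hD A ?_ (fun g t hg => hg.2 t) ?_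
    · have h1 : A = {g | ∀ s t, dist (g s) (g t) ≤ K * dist s t} ∩ {g | ∀ t, g t ∈ D} := by
        ext g
        exact and_congr lipschitzWith_iff_dist_le_mul Iff.rfl
      rw [h1]
      refine IsClosed.inter ?_ ?_
      · simp only [ofPred_forall]
        exact isClosed_iInter fun s => isClosed_iInter fun t =>
          isClosed_le ((continuous_eval_const s).dist (continuous_eval_const t)) continuous_const
      · simp only [ofPred_forall]
        exact isClosed_iInter fun t => hD.isClosed.preimage (continuous_eval_const t)
    · exact (LipschitzWith.uniformEquicontinuous _ K fun g : A => g.2.1).equicontinuous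
  let g : ℕ → (Icc (0 : ℝ) 1 →ᵇ Euc d) := fun n =>
    BoundedContinuousFunction.mkOfCompact
      ⟨fun t => η n t, (hη n).continuous.comp continuous_subtype_val⟩
  have hgA : ∀ n, g n ∈ A := fun n =>
    ⟨(mul_one K) ▸ (hη n).comp (LipschitzWith.subtype_val (Icc (0 : ℝ) 1)), fun t => hηD n t⟩
  obtain ⟨G, hG, ψ, hψ, hlim⟩ := hA.tendsto_subseq hgA
  refine ⟨ψ, hψ, IccExtend zero_le_one G, ?_, fun t => hG.2 _, ?_⟩
  · have h1 := hG.1.comp (LipschitzWith.projIcc (zero_le_one (α := ℝ)))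
    rwa [mul_one] at h1
  · rw [tendsto_iff_tendstoUniformly, Metric.tendstoUniformly_iff] at hlim
    rw [Metric.tendstoUniformlyOn_iff]
    intro e he
    filter_upwards [hlim e he] with k hk t ht
    rw [IccExtend_of_mem _ _ ht]
    exact hk ⟨t, ht⟩

end GeodesicApprox

/-! ### Removal of repeated vertices and reparametrization by length -/

namespace GeodesicApprox

/-- Quantitative strict convexity of `x ^ p` at `1`: the gap above the tangent line is nonnegative
and grows at least linearly outside `[1 - θ, 1 + θ]`. Averaged over the edges, it turns a nearly
sharp power mean inequality into smallness of the mean deviation from `1`. -/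
theorem exists_abs_sub_one_le_rpow_gap {p : ℝ} (hp : 1 < p) {θ : ℝ} (hθ : 0 < θ) :
    ∃ C : ℝ, 0 < C ∧ ∀ x : ℝ, 0 ≤ x → |x - 1| ≤ θ + C * (x ^ p - 1 - p * (x - 1)) := by
  wlog hθ1 : θ ≤ 1 generalizing θ
  · obtain ⟨C, hC, h⟩ := this one_pos le_rfl
    exact ⟨C, hC, fun x hx => (h x hx).trans (by linarith)⟩
  have h1 : 0 < (1 + θ) ^ p - 1 - p * θ := by
    linarith [one_add_mul_self_lt_rpow_one_add (s := θ) (by linarith) hθ.ne' hp]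
  have h2 : 0 < (1 - θ) ^ p - 1 + p * θ := by
    have := one_add_mul_self_lt_rpow_one_add (s := -θ) (by linarith) (by linarith) hp
    rw [← sub_eq_add_neg] at this
    linarith
  set κ := min ((1 + θ) ^ p - 1 - p * θ) ((1 - θ) ^ p - 1 + p * θ) with hκ
  have hκ0 : 0 < κ := lt_min h1 h2
  refine ⟨θ / κ, by positivity, fun x hx => ?_⟩
  have hpos : 0 ≤ x ^ p - 1 - p * (x - 1) := by
    have := one_add_mul_self_le_rpow_one_add (s := x - 1) (by linarith) hp.le
    rw [add_sub_cancel] at this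
    linarith
  rcases le_or_gt |x - 1| θ with hle | hgt
  · have : 0 ≤ θ / κ * (x ^ p - 1 - p * (x - 1)) := by positivity
    linarith
  · have hx1 : 0 < |x - 1| := hθ.trans hgt
    -- This weight makes `(1 - s) * 1 + s * x` equal to `1 + θ` or `1 - θ`, where the gap is at
    -- least `κ`; convexity then bounds the gap at `x` below by `κ / s`.
    set s := θ / |x - 1| with hs
    have hs0 : 0 ≤ s := by positivity
    have hs1 : s ≤ 1 := by rw [hs, div_le_one hx1]; exact hgt.le
    have hsx : s * |x - 1| = θ := by rw [hs]; field_simp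
    have hc := (convexOn_rpow hp.le).2 (mem_Ici.2 zero_le_one) (mem_Ici.2 hx)
      (sub_nonneg.2 hs1) hs0 (sub_add_cancel 1 s)
    simp only [smul_eq_mul, Real.one_rpow, mul_one] at hc
    have hκs : κ ≤ s * (x ^ p - 1 - p * (x - 1)) := by
      rcases abs_cases (x - 1) with ⟨ha, -⟩ | ⟨ha, -⟩
      · have h3 : 1 - s + s * x = 1 + θ := by rw [← hsx, ha]; ring
        rw [h3] at hc
        refine (min_le_left _ _).trans ?_
        have h4 : p * θ = s * (p * (x - 1)) := by rw [← hsx, ha]; ring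
        linarith
      · have h3 : 1 - s + s * x = 1 - θ := by rw [← hsx, ha]; ring
        rw [h3] at hc
        refine (min_le_right _ _).trans ?_
        have h4 : p * θ = - (s * (p * (x - 1))) := by rw [← hsx, ha]; ring
        linarith
    have h5 : |x - 1| ≤ θ / κ * (x ^ p - 1 - p * (x - 1)) := by
      rw [div_mul_eq_mul_div, le_div_iff₀ hκ0]
      calc |x - 1| * κ ≤ |x - 1| * (s * (x ^ p - 1 - p * (x - 1))) := by gcongr
        _ = s * |x - 1| * (x ^ p - 1 - p * (x - 1)) := by ring
        _ = _ := by rw [hsx]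
    linarith

variable {d : ℕ}

/-- The graph has no loops and the length reparametrization needs edges of positive length, so
consecutive repetitions must go. Every edge of `w` is an edge of `u`, so step bounds are inherited.
-/
theorem exists_dedup (u : ℕ → Euc d) (n : ℕ) : ∃ (k : ℕ) (w : ℕ → Euc d), k ≤ n ∧ w 0 = u 0 ∧
    w k = u n ∧ (∀ i < k, w i ≠ w (i + 1)) ∧
    (∀ i < k, ∃ j < n, w i = u j ∧ w (i + 1) = u (j + 1)) ∧
    ∀ g : Euc d → Euc d → ℝ, (∀ i < n, g (u i) (u i) = 0) →
      ∑ i ∈ Finset.range k, g (w i) (w (i + 1)) = ∑ i ∈ Finset.range n, g (u i) (u (i + 1)) := by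
  induction n with
  | zero => exact ⟨0, u, le_rfl, rfl, rfl, by simp, by simp, by simp⟩
  | succ n ih =>
    obtain ⟨k, w, hk, h0, h1, hne, hedge, hsum⟩ := ih
    by_cases heq : u n = u (n + 1)
    · refine ⟨k, w, by omega, h0, h1.trans heq, hne, fun i hi => ?_, fun g hg => ?_⟩
      · obtain ⟨j, hj, h⟩ := hedge i hi
        exact ⟨j, by omega, h⟩
      · rw [hsum g fun i hi => hg i (by omega), Finset.sum_range_succ, ← heq, hg n (by omega),
          add_zero]
    · set w' : ℕ → Euc d := fun j => if j ≤ k then w j else u (n + 1) with hw'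
      have hle : ∀ j ≤ k, w' j = w j := fun j hj => if_pos hj
      have hlast : w' (k + 1) = u (n + 1) := if_neg (by omega)
      refine ⟨k + 1, w', by omega, by rw [hle 0 (by omega), h0], hlast, fun i hi => ?_,
        fun i hi => ?_, fun g hg => ?_⟩
      · rcases (Nat.lt_succ_iff_lt_or_eq.1 hi) with h | rfl
        · rw [hle i h.le, hle (i + 1) h]
          exact hne i h
        · rwa [hle i le_rfl, hlast, h1]
      · rcases (Nat.lt_succ_iff_lt_or_eq.1 hi) with h | rfl
        · obtain ⟨j, hj, h2⟩ := hedge i h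
          exact ⟨j, by omega, by rwa [hle i h.le, hle (i + 1) h]⟩
        · exact ⟨n, by omega, by rw [hle i le_rfl, h1], hlast⟩
      · rw [Finset.sum_range_succ, Finset.sum_range_succ, hlast, hle k le_rfl, h1,
          ← hsum g fun i hi => hg i (by omega)]
        congr 1
        refine Finset.sum_congr rfl fun i hi => ?_
        rw [Finset.mem_range] at hi
        rw [hle i hi.le, hle (i + 1) hi]

namespace CostBounds

variable {D : Set (Euc d)} {p : ℝ} {f : Euc d → Euc d → ℝ} {m₁ m₂ c : ℝ}

/-- Homogeneity extracts the factor `m ^ (p - 1)`, which increases with `m`. Deleting zero-length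
edges keeps the sum and can only lower this factor. -/
theorem riemannCost_eq (h : CostBounds D p f m₁ m₂ c) {v : DiscretePath d} (hm : 1 ≤ v.steps)
    (hv : ∀ i < v.steps, v.vertex i ∈ D) :
    riemannCost f v = (v.steps : ℝ) ^ (p - 1) *
      ∑ i ∈ Finset.range v.steps, f (v.vertex i) (v.vertex (i + 1) - v.vertex i) := by
  have hm0 : (0 : ℝ) < v.steps := by exact_mod_cast hm
  have h1 : ∀ i ∈ Finset.range v.steps,
      f (v.vertex i) ((v.steps : ℝ) • (v.vertex (i + 1) - v.vertex i)) =
      (v.steps : ℝ) ^ p * f (v.vertex i) (v.vertex (i + 1) - v.vertex i) := fun i hi =>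
    h.homogeneous _ (hv i (Finset.mem_range.1 hi)) _ _ hm0
  rw [riemannCost, Finset.sum_congr rfl h1, ← Finset.mul_sum, ← mul_assoc, Real.rpow_sub_one hm0.ne']
  ring

/-- Removing repeated consecutive vertices does not increase the cost. -/
theorem exists_dedup_riemannCost_le (h : CostBounds D p f m₁ m₂ c) (v : DiscretePath d)
    (hv : ∀ i ≤ v.steps, v.vertex i ∈ D) (hne : v.vertex 0 ≠ v.vertex v.steps) :
    ∃ w : DiscretePath d, 1 ≤ w.steps ∧ w.vertex 0 = v.vertex 0 ∧
      w.vertex w.steps = v.vertex v.steps ∧ (∀ i < w.steps, w.vertex i ≠ w.vertex (i + 1)) ∧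
      (∀ i < w.steps, ∃ j < v.steps,
        w.vertex i = v.vertex j ∧ w.vertex (i + 1) = v.vertex (j + 1)) ∧
      riemannCost f w ≤ riemannCost f v := by
  obtain ⟨k, w, hk, h0, h1, hne', hedge, hsum⟩ := exists_dedup v.vertex v.steps
  have hk1 : 1 ≤ k := by
    rcases Nat.eq_zero_or_pos k with rfl | h'
    · exact absurd (h0.symm.trans h1) hne
    · exact h'
  refine ⟨⟨k, w⟩, hk1, h0, h1, hne', hedge, ?_⟩
  have hwD : ∀ i < k, w i ∈ D := fun i hi => by
    obtain ⟨j, hj, h2, -⟩ := hedge i hi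
    rw [h2]; exact hv j hj.le
  rw [h.riemannCost_eq (v := ⟨k, w⟩) hk1 hwD,
    h.riemannCost_eq (hk1.trans hk) fun i hi => hv i hi.le]
  dsimp only
  rw [hsum (fun x y => f x (y - x)) fun i hi => by
    rw [sub_self]; exact h.map_zero (hv i hi.le)]
  have h2 : 0 ≤ p - 1 := by linarith [h.one_lt]
  gcongr
  exact Finset.sum_nonneg fun i hi => h.nonneg (hv i (Finset.mem_range.1 hi).le) _

/-- Reparametrization of a polygonal path proportionally to its `f ^ (1 / p)`-length `L`. -/
theorem exists_reparametrization (h : CostBounds D p f m₁ m₂ c) {v : DiscretePath d}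
    (hm : 1 ≤ v.steps) (hv : ∀ i ≤ v.steps, v.vertex i ∈ D)
    (hne : ∀ i < v.steps, v.vertex i ≠ v.vertex (i + 1)) {δ : ℝ}
    (hδ : ∀ i < v.steps, ‖v.vertex (i + 1) - v.vertex i‖ ≤ δ) :
    ∃ (L : ℝ) (K : NNReal) (η : ℝ → Euc d), 0 < L ∧ (K : ℝ) = L / m₁ ^ (1 / p) ∧
      LipschitzWith K η ∧ (∀ t, η t ∈ D) ∧ η 0 = v.vertex 0 ∧ η 1 = v.vertex v.steps ∧
      L ^ p ≤ riemannCost f v ∧ pathCost f η ≤ (1 + c * δ / m₁) * L ^ p ∧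
      ∀ t ∈ Icc (0 : ℝ) 1,
        dist (linInterp v t) (η t) ≤ (1 + m₂ ^ (1 / p) / m₁ ^ (1 / p)) * δ + K ∧
        ∀ θ C : ℝ, 0 ≤ C →
          (∀ x : ℝ, 0 ≤ x → |x - 1| ≤ θ + C * (x ^ p - 1 - p * (x - 1))) →
          dist (linInterp v t) (η t) ≤ (1 + m₂ ^ (1 / p) / m₁ ^ (1 / p)) * δ +
            K * (θ + C * (riemannCost f v / L ^ p - 1)) := by
  obtain ⟨m, v⟩ := v
  dsimp only at hm hv hne hδ ⊢
  have hp0 := h.p_pos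
  have hpi : 0 < 1 / p := by positivity
  have hm₁ := h.m₁_pos
  have hm₂ := h.m₂_pos
  have hm0 : (0 : ℝ) < m := by exact_mod_cast hm
  set r := m₁ ^ (1 / p) with hr
  have hr0 : 0 < r := Real.rpow_pos_of_pos hm₁ _
  -- The length of an edge, with `f` frozen at its initial vertex. It is comparable to the Euclidean
  -- length through `m₁ ^ (1 / p)` and `m₂ ^ (1 / p)`.
  set e : ℕ → ℝ := fun i => f (v i) (v (i + 1) - v i) ^ (1 / p) with he
  have hfe : ∀ i < m, f (v i) (v (i + 1) - v i) = e i ^ p := fun i hi => by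
    rw [he]
    dsimp only
    rw [← Real.rpow_mul (h.nonneg (hv i hi.le) _), one_div_mul_cancel hp0.ne', Real.rpow_one]
  have hre : ∀ i < m, r * ‖v (i + 1) - v i‖ ≤ e i := fun i hi => by
    have h1 := Real.rpow_le_rpow (by positivity) (h.lower (v i) (hv i hi.le) (v (i + 1) - v i)) hpi.le
    rwa [Real.mul_rpow hm₁.le (by positivity), ← Real.rpow_mul (norm_nonneg _),
      mul_one_div_cancel hp0.ne', Real.rpow_one] at h1
  have hep : ∀ i < m, 0 < e i := fun i hi =>
    (mul_pos hr0 (norm_pos_iff.2 (sub_ne_zero.2 (hne i hi).symm))).trans_le (hre i hi)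
  have heu : ∀ i < m, e i ≤ m₂ ^ (1 / p) * δ := fun i hi => by
    have h1 := Real.rpow_le_rpow (h.nonneg (hv i hi.le) _)
      (h.upper (v i) (hv i hi.le) (v (i + 1) - v i)) hpi.le
    rw [Real.mul_rpow hm₂.le (by positivity), ← Real.rpow_mul (norm_nonneg _),
      mul_one_div_cancel hp0.ne', Real.rpow_one] at h1
    exact h1.trans (by gcongr; exact hδ i hi)
  set L := ∑ i ∈ Finset.range m, e i with hL
  have hL0 : 0 < L := Finset.sum_pos (fun i hi => hep i (Finset.mem_range.1 hi))
    ⟨0, Finset.mem_range.2 hm⟩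
  set T : ℕ → ℝ := fun i => (∑ j ∈ Finset.range i, e j) / L with hTdef
  have hτ : ∀ i, T (i + 1) - T i = e i / L := fun i => by
    simp only [hTdef, Finset.sum_range_succ]; ring
  have hT0 : T 0 = 0 := by simp [hTdef]
  have hT1 : T m = 1 := div_self hL0.ne'
  have hT : StrictMonoOn T (Iic m) := by
    refine strictMonoOn_Iic_of_lt_succ fun i hi => ?_
    have h1 := hτ i
    have h2 : 0 < e i / L := div_pos (hep i hi) hL0
    rw [Order.succ_eq_add_one]
    linarith
  let K : NNReal := ⟨L / r, by positivity⟩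
  have hKr : (K : ℝ) = L / r := rfl
  have hK : ∀ i < m, ‖v (i + 1) - v i‖ ≤ K * (T (i + 1) - T i) := fun i hi => by
    rw [hτ, hKr, div_mul_div_comm, mul_comm L, mul_div_mul_right _ _ hL0.ne', le_div_iff₀' hr0]
    exact hre i hi
  have hlip := lipschitzWith_polygon hT hK
  -- An edge traversed in time `e i / L` has frozen cost `e i * L ^ (p - 1)`, and the `e i` add up
  -- to `L`.
  have hfrozen : ∑ i ∈ Finset.range m,
      (T (i + 1) - T i) * f (v i) ((T (i + 1) - T i)⁻¹ • (v (i + 1) - v i)) = L ^ p := by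
    have h1 : ∀ i ∈ Finset.range m, (T (i + 1) - T i) *
        f (v i) ((T (i + 1) - T i)⁻¹ • (v (i + 1) - v i)) = e i * L ^ (p - 1) := fun i hi => by
      have hi' := Finset.mem_range.1 hi
      have hei := hep i hi'
      rw [hτ, h.homogeneous _ (hv i hi'.le) _ _ (by positivity), hfe i hi', inv_div,
        Real.div_rpow hL0.le hei.le, Real.rpow_sub_one hL0.ne']
      have := (Real.rpow_pos_of_pos hei p).ne'
      field_simp
    rw [Finset.sum_congr rfl h1, ← Finset.sum_mul, Real.rpow_sub_one hL0.ne', ← hL]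
    field_simp
  have hH : riemannCost f ⟨m, v⟩ / L ^ p = 1 / m * ∑ i ∈ Finset.range m, (m * e i / L) ^ p := by
    have h1 : ∀ i ∈ Finset.range m, (m * e i / L) ^ p =
        (m : ℝ) ^ p * f (v i) (v (i + 1) - v i) / L ^ p := fun i hi => by
      have hi' := Finset.mem_range.1 hi
      have hei := hep i hi'
      rw [hfe i hi', Real.div_rpow (by positivity) hL0.le, Real.mul_rpow hm0.le hei.le]
    rw [h.riemannCost_eq (v := ⟨m, v⟩) hm fun i hi => hv i hi.le, Finset.sum_congr rfl h1,
      ← Finset.sum_div, ← Finset.mul_sum, Real.rpow_sub_one hm0.ne']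
    ring
  have hmean : ∑ i ∈ Finset.range m, m * e i / L = m := by
    rw [← Finset.sum_div, ← Finset.mul_sum, ← hL]
    field_simp
  -- The normalized lengths `m * e i / L` have mean `1`, so the linear term averages to zero and the
  -- mean gap is exactly the defect in the power mean inequality.
  have hgap : 1 / m * ∑ i ∈ Finset.range m,
      ((m * e i / L) ^ p - 1 - p * (m * e i / L - 1)) = riemannCost f ⟨m, v⟩ / L ^ p - 1 := by
    rw [hH]
    simp only [Finset.sum_sub_distrib, ← Finset.mul_sum, hmean, Finset.sum_const,
      Finset.card_range, nsmul_eq_mul]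
    field_simp
    ring
  refine ⟨L, K, polygon m T v, hL0, hKr, hlip, polygon_mem h.convexDomain hm hT hv, ?_, ?_, ?_, ?_,
    fun t ht => ?_⟩
  · rw [← hT0]
    exact polygon_knot hm hT v (Nat.zero_le _)
  · rw [← hT1]
    exact polygon_knot hm hT v le_rfl
  · have h1 : 0 ≤ 1 / m * ∑ i ∈ Finset.range m,
        ((m * e i / L) ^ p - 1 - p * (m * e i / L - 1)) := by
      refine mul_nonneg (by positivity) (Finset.sum_nonneg fun i hi => ?_)
      have hei := hep i (Finset.mem_range.1 hi)
      have h2 : 0 ≤ m * e i / L := by positivity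
      have := one_add_mul_self_le_rpow_one_add (s := m * e i / L - 1) (by linarith) h.one_lt.le
      rw [add_sub_cancel] at this
      linarith
    rw [hgap, sub_nonneg, one_le_div (by positivity)] at h1
    exact h1
  · have h1 := h.abs_pathCost_polygon_sub_le hm hT hT0 hT1 hv hK hδ
    rw [hfrozen] at h1
    linarith [(abs_le.1 h1).2]
  · obtain ⟨i, hi, hit⟩ := exists_mem_Icc_knots hm (fun i : ℕ => (i : ℝ) / m) (t := t)
      (by simpa using ht.1) (by simpa [div_self hm0.ne'] using ht.2)
    have hstep := uniform_knots_sub m i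
    have hK0 : (0 : ℝ) ≤ K := K.2
    have h1 : dist (linInterp ⟨m, v⟩ t) (v i) ≤ δ := by
      rw [linInterp_eqOn_polygon ⟨m, v⟩ hm ht]
      dsimp only
      rw [polygon_eq (strictMonoOn_uniform_knots hm) v hi hit, dist_eq_norm, add_sub_cancel_left,
        norm_smul]
      refine (mul_le_of_le_one_left (norm_nonneg _) ?_).trans (hδ i hi)
      rw [hstep, Real.norm_eq_abs, abs_of_nonneg (by
        have := sub_nonneg.2 hit.1; positivity), div_le_one (by positivity)]
      linarith [hit.2]
    have h2 : dist (v i) (polygon m T v t) ≤ K * (|T i - (i : ℝ) / m| + 1 / m) := by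
      rw [← polygon_knot hm hT v hi.le]
      refine (hlip.dist_le_mul _ _).trans (mul_le_mul_of_nonneg_left ?_ hK0)
      have h3 : dist ((i : ℝ) / m) t ≤ 1 / m := by
        rw [dist_comm, Real.dist_eq, abs_of_nonneg (sub_nonneg.2 hit.1)]
        linarith [hit.2]
      exact (dist_triangle _ ((i : ℝ) / m) _).trans (add_le_add le_rfl h3)
    -- `L` is at most `m` times the largest edge length, so `K / m` is of the order of the mesh.
    have h3 : K * (1 / m) ≤ m₂ ^ (1 / p) / r * δ := by
      have h4 : L ≤ m * (m₂ ^ (1 / p) * δ) := by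
        have := Finset.sum_le_card_nsmul (Finset.range m) e (m₂ ^ (1 / p) * δ)
          fun i hi => heu i (Finset.mem_range.1 hi)
        rwa [Finset.card_range, nsmul_eq_mul] at this
      rw [hKr, div_mul_div_comm, mul_one, div_mul_eq_mul_div, div_le_div_iff₀ (by positivity) hr0]
      nlinarith
    have h5 : dist (linInterp ⟨m, v⟩ t) (polygon m T v t) ≤
        (1 + m₂ ^ (1 / p) / r) * δ + K * |T i - (i : ℝ) / m| := by
      have := dist_triangle (linInterp ⟨m, v⟩ t) (v i) (polygon m T v t)
      linarith
    refine ⟨h5.trans ?_, fun θ C hC hθ => h5.trans ?_⟩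
    · have h6 : |T i - (i : ℝ) / m| ≤ 1 := by
        have h7 : 0 ≤ T i := by
          rw [← hT0]; exact hT.monotoneOn (mem_Iic.2 (by omega)) (mem_Iic.2 hi.le) (by omega)
        have h8 : T i ≤ 1 := by
          rw [← hT1]; exact hT.monotoneOn (mem_Iic.2 hi.le) (mem_Iic.2 le_rfl) hi.le
        have h9 : (0 : ℝ) ≤ (i : ℝ) / m := by positivity
        have h10 : (i : ℝ) / m ≤ 1 := by
          rw [div_le_one hm0]; exact_mod_cast hi.le
        rw [abs_le]
        constructor <;> linarith
      have := mul_le_of_le_one_right hK0 h6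
      linarith
    · gcongr
      -- The discrepancy between the two clocks at vertex `i` is a partial sum of the deviations of
      -- the normalized lengths from `1`.
      have h6 : T i - (i : ℝ) / m = ∑ j ∈ Finset.range i, 1 / m * (m * e j / L - 1) := by
        rw [← Finset.mul_sum, Finset.sum_sub_distrib, ← Finset.sum_div, ← Finset.mul_sum,
          Finset.sum_const, Finset.card_range, nsmul_eq_mul, hTdef]
        field_simp
      rw [h6]
      calc |∑ j ∈ Finset.range i, 1 / m * (m * e j / L - 1)|
          ≤ ∑ j ∈ Finset.range i, |1 / m * (m * e j / L - 1)| := Finset.abs_sum_le_sum_abs _ _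
        _ ≤ ∑ j ∈ Finset.range m, |1 / m * (m * e j / L - 1)| :=
          Finset.sum_le_sum_of_subset_of_nonneg (Finset.range_subset_range.2 hi.le)
            fun _ _ _ => abs_nonneg _
        _ ≤ ∑ j ∈ Finset.range m, 1 / m *
            (θ + C * ((m * e j / L) ^ p - 1 - p * (m * e j / L - 1))) := by
          refine Finset.sum_le_sum fun j hj => ?_
          have hej := hep j (Finset.mem_range.1 hj)
          rw [abs_mul, abs_of_pos (by positivity : (0 : ℝ) < 1 / m)]
          gcongr
          exact hθ _ (by positivity)
        _ = θ + C * (1 / m * ∑ j ∈ Finset.range m,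
            ((m * e j / L) ^ p - 1 - p * (m * e j / L - 1))) := by
          rw [← Finset.mul_sum, Finset.sum_add_distrib, ← Finset.mul_sum, Finset.sum_const,
            Finset.card_range, nsmul_eq_mul]
          field_simp
        _ = _ := by rw [hgap]

end CostBounds
end GeodesicApprox

/-! ### Existence of minimizers of the path cost -/

namespace GeodesicApprox

variable {d : ℕ}

namespace CostBounds

variable {D : Set (Euc d)} {p : ℝ} {f : Euc d → Euc d → ℝ} {m₁ m₂ c : ℝ}

theorem pathCost_nonneg (h : CostBounds D p f m₁ m₂ c) {a b : Euc d} {γ : ℝ → Euc d}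
    (hγ : γ ∈ lipPaths D a b) : 0 ≤ pathCost f γ :=
  intervalIntegral.integral_nonneg zero_le_one fun _ ht => h.nonneg (hγ.2.1 ht) _

theorem pathCost_const (h : CostBounds D p f m₁ m₂ c) {a : Euc d} (ha : a ∈ D) :
    pathCost f (fun _ => a) = 0 := by
  simp [pathCost, h.map_zero ha]

theorem exists_subseq_limit (h : CostBounds D p f m₁ m₂ c) {a b : Euc d} {K : NNReal}
    {η : ℕ → ℝ → Euc d} (hη : ∀ n, LipschitzWith K (η n)) (hηD : ∀ n t, η n t ∈ D)
    (h0 : ∀ n, η n 0 = a) (h1 : ∀ n, η n 1 = b) {M : ℝ}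
    (hM : Tendsto (fun n => pathCost f (η n)) atTop (𝓝 M)) :
    ∃ ψ : ℕ → ℕ, StrictMono ψ ∧ ∃ γ ∈ lipPaths D a b, pathCost f γ ≤ M ∧
      TendstoUniformlyOn (fun k => η (ψ k)) γ atTop (Icc 0 1) := by
  obtain ⟨ψ, hψ, γ, hγ, hγD, hlim⟩ := exists_subseq_tendstoUniformlyOn h.isCompact hη hηD
  have hpt : ∀ t ∈ Icc (0 : ℝ) 1, Tendsto (fun k => η (ψ k) t) atTop (𝓝 (γ t)) :=
    fun t ht => hlim.tendsto_at ht
  have e0 : γ 0 = a := tendsto_nhds_unique (hpt 0 ⟨le_rfl, zero_le_one⟩) (by simp [h0])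
  have e1 : γ 1 = b := tendsto_nhds_unique (hpt 1 ⟨zero_le_one, le_rfl⟩) (by simp [h1])
  refine ⟨ψ, hψ, γ, ?_, ?_, hlim⟩
  · rw [← e0, ← e1]
    exact mem_lipPaths hγ hγD
  · exact h.pathCost_le_of_tendsto (fun n => hη (ψ n)) (fun n => hηD (ψ n)) hγ hγD hpt
      (hM.comp hψ.tendsto_atTop)

theorem lipPaths_nonempty (h : CostBounds D p f m₁ m₂ c) {a b : Euc d} (ha : a ∈ D) (hb : b ∈ D) :
    (lipPaths D a b).Nonempty := by
  have hv : ∀ i ≤ 1, (fun i : ℕ => if i = 0 then a else b) i ∈ D := fun i _ => by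
    dsimp only; split_ifs <;> assumption
  have := linInterp_mem_lipPaths h.convexDomain
    (v := ⟨1, fun i => if i = 0 then a else b⟩) le_rfl hv
  exact ⟨_, by simpa using this⟩

/-- A path can be replaced by one of almost the same cost whose Lipschitz constant is controlled
by the cost. -/
theorem exists_lipschitzWith_pathCost_le (h : CostBounds D p f m₁ m₂ c) {a b : Euc d}
    (hab : a ≠ b) {γ : ℝ → Euc d} (hγ : γ ∈ lipPaths D a b) {e : ℝ} (he : 0 < e) :
    ∃ (K : NNReal) (η : ℝ → Euc d), (K : ℝ) ≤ (pathCost f γ + e) ^ (1 / p) / m₁ ^ (1 / p) ∧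
      LipschitzWith K η ∧ (∀ t, η t ∈ D) ∧ η 0 = a ∧ η 1 = b ∧
      pathCost f η ≤ (1 + c * e / m₁) * (pathCost f γ + e) := by
  obtain ⟨K, γ', hK, hD, heq, h0, h1⟩ := exists_extension_of_mem_lipPaths hγ
  have hcost := pathCost_congr f heq
  have t1 : Tendsto (fun m : ℕ => c * (K : ℝ) ^ (p + 1) / m) atTop (𝓝 0) :=
    tendsto_const_div_atTop_nhds_zero_nat _
  have t2 : Tendsto (fun m : ℕ => (K : ℝ) / m) atTop (𝓝 0) :=
    tendsto_const_div_atTop_nhds_zero_nat _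
  -- The sampling is fine enough for `e` to bound both the Jensen error and the mesh `K / m`.
  obtain ⟨m, hm1, hm2, hm⟩ := ((t1.eventually_le_const he).and ((t2.eventually_le_const he).and
    (eventually_ge_atTop 1))).exists
  have hm0 : (0 : ℝ) < m := by exact_mod_cast hm
  have e0 : (samplePath γ' m).vertex 0 = a := by simp [samplePath, h0]
  have e1 : (samplePath γ' m).vertex m = b := by simp [samplePath, h1, div_self hm0.ne']
  obtain ⟨w, hw, hw0, hw1, hne, hedge, hle⟩ := h.exists_dedup_riemannCost_le (samplePath γ' m)
    (fun i _ => hD _) (by rw [e0]; exact fun h' => hab (h'.trans e1))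
  have hwD : ∀ i ≤ w.steps, w.vertex i ∈ D := fun i hi => by
    rcases hi.lt_or_eq with h' | rfl
    · obtain ⟨j, -, h2, -⟩ := hedge i h'
      rw [h2]; exact hD _
    · rw [hw1]; exact hD _
  have hδ : ∀ i < w.steps, ‖w.vertex (i + 1) - w.vertex i‖ ≤ e := fun i hi => by
    obtain ⟨j, -, h2, h3⟩ := hedge i hi
    rw [h2, h3, ← dist_eq_norm]
    refine (hK.dist_le_mul _ _).trans (le_trans (le_of_eq ?_) hm2)
    have := uniform_knots_sub m j
    rw [Real.dist_eq, this, abs_of_pos (by positivity)]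
    ring
  obtain ⟨L, K', η, hL, hK', hη, hηD, hη0, hη1, hLH, hηF, -⟩ :=
    h.exists_reparametrization hw hwD hne hδ
  have hH : L ^ p ≤ pathCost f γ + e := by
    have := h.riemannCost_samplePath_le hK hD hm
    rw [hcost] at this
    linarith
  refine ⟨K', η, ?_, hη, hηD, hη0.trans (hw0.trans e0), hη1.trans (hw1.trans e1),
    hηF.trans ?_⟩
  · have h2 := Real.rpow_le_rpow (by positivity) hH (z := 1 / p) (by have := h.p_pos; positivity)
    rw [← Real.rpow_mul hL.le, mul_one_div_cancel h.p_pos.ne', Real.rpow_one] at h2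
    have := h.m₁_pos
    rw [hK']
    gcongr
  · have := h.m₁_pos
    have := h.c_nonneg
    gcongr

/-- The direct method, applied to a minimizing sequence made uniformly Lipschitz by resampling and
reparametrization. The case `a = b` is separate, since removing repetitions could leave no edge at
all; there the constant path has cost zero. -/
theorem exists_pathCost_minimizer (h : CostBounds D p f m₁ m₂ c) {a b : Euc d} (ha : a ∈ D)
    (hb : b ∈ D) : ∃ γ, γ ∈ argminOn (pathCost f) (lipPaths D a b) := by
  rcases eq_or_ne a b with rfl | hab
  · refine ⟨fun _ => a, ⟨⟨0, (LipschitzWith.const a).lipschitzOnWith⟩, fun _ _ => ha, rfl, rfl⟩,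
      fun η hη => ?_⟩
    rw [h.pathCost_const ha]
    exact h.pathCost_nonneg hη
  set M := sInf (pathCost f '' lipPaths D a b) with hM
  have hbdd : BddBelow (pathCost f '' lipPaths D a b) :=
    ⟨0, by rintro _ ⟨γ, hγ, rfl⟩; exact h.pathCost_nonneg hγ⟩
  have hne := (h.lipPaths_nonempty ha hb).image (pathCost f)
  have hMle : ∀ γ ∈ lipPaths D a b, M ≤ pathCost f γ := fun γ hγ =>
    csInf_le hbdd ⟨γ, hγ, rfl⟩
  have hm₁ := h.m₁_pos
  have hc := h.c_nonneg
  have hp := h.p_pos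
  -- With `e = 1 / (n + 1) ≤ 1`, a path of cost below `M + e` has `pathCost f γ + e ≤ M + 2 * e ≤ M
  -- + 2`, whence a Lipschitz constant independent of `n`.
  have hex : ∀ n : ℕ, ∃ (η : ℝ → Euc d),
      LipschitzWith ((M + 2) ^ (1 / p) / m₁ ^ (1 / p)).toNNReal η ∧ (∀ t, η t ∈ D) ∧ η 0 = a ∧
      η 1 = b ∧ pathCost f η ≤ (1 + c * (1 / ((n : ℝ) + 1)) / m₁) *
        (M + 2 * (1 / ((n : ℝ) + 1))) := fun n => by
    have he : 0 < 1 / ((n : ℝ) + 1) := by positivity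
    have he1 : 1 / ((n : ℝ) + 1) ≤ 1 := by
      rw [div_le_one (by positivity)]
      linarith [Nat.cast_nonneg (α := ℝ) n]
    obtain ⟨_, ⟨γ, hγ, rfl⟩, hlt⟩ := exists_lt_of_csInf_lt hne (lt_add_of_pos_right M he)
    obtain ⟨K, η, hK, hη, hηD, h0, h1, hcost⟩ := h.exists_lipschitzWith_pathCost_le hab hγ he
    have h2 := h.pathCost_nonneg hγ
    refine ⟨η, hη.weaken ?_, hηD, h0, h1, hcost.trans ?_⟩
    · rw [← NNReal.coe_le_coe]
      refine hK.trans ((?_ : _ ≤ (M + 2) ^ (1 / p) / m₁ ^ (1 / p)).trans (Real.le_coe_toNNReal _))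
      exact div_le_div_of_nonneg_right (Real.rpow_le_rpow (by positivity) (by linarith)
        (by positivity)) (by positivity)
    · exact mul_le_mul_of_nonneg_left (by linarith) (by positivity)
  choose η hη hηD h0 h1 hcost using hex
  have t0 := tendsto_one_div_add_atTop_nhds_zero_nat (𝕜 := ℝ)
  have t1 : Tendsto (fun n : ℕ => (1 + c * (1 / ((n : ℝ) + 1)) / m₁) *
      (M + 2 * (1 / ((n : ℝ) + 1)))) atTop (𝓝 M) := by
    have := ((((t0.const_mul c).div_const m₁).const_add 1).mul ((t0.const_mul 2).const_add M))
    simpa using this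
  have t2 : Tendsto (fun n => pathCost f (η n)) atTop (𝓝 M) :=
    tendsto_of_tendsto_of_tendsto_of_le_of_le tendsto_const_nhds t1
      (fun n => hMle _ (by rw [← h0 n, ← h1 n]; exact mem_lipPaths (hη n) (hηD n))) hcost
  obtain ⟨-, -, γ, hγ, hγM, -⟩ := h.exists_subseq_limit hη hηD h0 h1 t2
  exact ⟨γ, hγ, fun ξ hξ => hγM.trans (hMle ξ hξ)⟩

end CostBounds

/-! ### Discrete minimizers and the upper bound by graph paths -/

theorem finite_graphVertices (x : ℕ → Euc d) (n : ℕ) (a b : Euc d) :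
    (graphVertices x n a b).Finite :=
  ((Set.finite_Iio n).image x).union (Set.toFinite {a, b})

theorem graphPaths_vertex_mem {x : ℕ → Euc d} {n : ℕ} {ε : ℝ} {a b : Euc d} {v : DiscretePath d}
    (hv : v ∈ graphPaths x n ε a b) {i : ℕ} (hi : i ≤ v.steps) :
    v.vertex i ∈ graphVertices x n a b := by
  rcases hi.lt_or_eq with h | rfl
  · exact (hv.2.2.2 i h).1
  · rw [hv.2.2.1]
    exact Or.inr (by simp)

theorem graphVertices_subset {D : Set (Euc d)} {x : ℕ → Euc d} (hx : ∀ i, x i ∈ D) {a b : Euc d}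
    (ha : a ∈ D) (hb : b ∈ D) (n : ℕ) : graphVertices x n a b ⊆ D := by
  rintro y (⟨i, -, rfl⟩ | rfl | rfl)
  · exact hx i
  · exact ha
  · exact hb

theorem riemannCost_congr (f : Euc d → Euc d → ℝ) (m : ℕ) {u w : ℕ → Euc d}
    (huw : ∀ i ≤ m, u i = w i) : riemannCost f ⟨m, u⟩ = riemannCost f ⟨m, w⟩ := by
  unfold riemannCost
  dsimp only
  congr 1
  refine Finset.sum_congr rfl fun i hi => ?_
  rw [Finset.mem_range] at hi
  rw [huw i hi.le, huw (i + 1) hi]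

namespace CostBounds

variable {D : Set (Euc d)} {p : ℝ} {f : Euc d → Euc d → ℝ} {m₁ m₂ c : ℝ}

/-- Graph paths may be arbitrarily long. Every edge is at least as long as the least distance `δ`
between distinct vertices, so a path costs at least `m₁ * δ ^ p` per step; long paths lose to a
fixed one, and the short ones take finitely many cost values. -/
theorem exists_isLeast_riemannCost (h : CostBounds D p f m₁ m₂ c) {x : ℕ → Euc d}
    (hx : ∀ i, x i ∈ D) {a b : Euc d} (ha : a ∈ D) (hb : b ∈ D) {n : ℕ} {ε : ℝ}
    (hne : (graphPaths x n ε a b).Nonempty) :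
    ∃ y, IsLeast (riemannCost f '' graphPaths x n ε a b) y := by
  set V := graphVertices x n a b with hV
  have hVfin : V.Finite := finite_graphVertices x n a b
  have hVD : V ⊆ D := graphVertices_subset hx ha hb n
  obtain ⟨δ, hδV, hδ⟩ : ∃ δ : ℝ, (∀ q ∈ V ×ˢ V, q.1 ≠ q.2 → δ ≤ dist q.1 q.2) ∧ 0 < δ := by
    have h1 : ∀ᶠ δ : ℝ in 𝓝[>] 0, ∀ q ∈ V ×ˢ V, q.1 ≠ q.2 → δ ≤ dist q.1 q.2 := by
      rw [Filter.eventually_all_finite (hVfin.prod hVfin)]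
      intro q _
      by_cases hq : q.1 = q.2
      · simp [hq]
      · filter_upwards [Ioo_mem_nhdsGT (dist_pos.2 hq)] with δ hδ _
        exact hδ.2.le
    exact (h1.and self_mem_nhdsWithin).exists
  set A := m₁ * δ ^ p with hA
  have hA0 : 0 < A := mul_pos h.m₁_pos (Real.rpow_pos_of_pos hδ p)
  have hlow : ∀ v ∈ graphPaths x n ε a b, v.steps * A ≤ riemannCost f v := by
    intro v hv
    have hm0 : (1 : ℝ) ≤ v.steps := by exact_mod_cast hv.1
    rw [h.riemannCost_eq hv.1 fun i hi => hVD (graphPaths_vertex_mem hv hi.le)]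
    have h1 : ∀ i ∈ Finset.range v.steps,
        A ≤ f (v.vertex i) (v.vertex (i + 1) - v.vertex i) := fun i hi => by
      rw [Finset.mem_range] at hi
      have h2 := hv.2.2.2 i hi
      refine le_trans ?_ (h.lower _ (hVD h2.1) _)
      have h3 := hδV (_, _) ⟨h2.1, h2.2.1⟩ (dist_pos.1 h2.2.2.1)
      rw [dist_comm, dist_eq_norm] at h3
      have := h.p_pos
      have := h.m₁_pos
      rw [hA]
      gcongr
    have h2 := Finset.card_nsmul_le_sum _ _ _ h1
    rw [Finset.card_range, nsmul_eq_mul] at h2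
    have h3 : 1 ≤ (v.steps : ℝ) ^ (p - 1) := Real.one_le_rpow hm0 (by linarith [h.one_lt])
    have h4 : 0 ≤ v.steps * A := by positivity
    nlinarith
  obtain ⟨v₀, hv₀⟩ := hne
  set N := ⌈riemannCost f v₀ / A⌉₊ with hN
  set S := riemannCost f '' {v ∈ graphPaths x n ε a b | v.steps ≤ N} with hS
  have hSfin : S.Finite := by
    have h1 : S ⊆ ⋃ m ∈ Iic N, (fun u : Fin (m + 1) → Euc d => riemannCost f
        ⟨m, fun i => if hi : i < m + 1 then u ⟨i, hi⟩ else 0⟩) '' {u | ∀ i, u i ∈ V} := by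
      rintro _ ⟨v, ⟨hv, hvN⟩, rfl⟩
      refine mem_biUnion (mem_Iic.2 hvN) ⟨fun i => v.vertex i, fun i => ?_, ?_⟩
      · exact graphPaths_vertex_mem hv (Nat.lt_succ_iff.1 i.2)
      · refine riemannCost_congr f v.steps (w := v.vertex) fun i hi => ?_
        rw [dif_pos (Nat.lt_succ_of_le hi)]
    refine Set.Finite.subset ((finite_Iic N).biUnion fun m _ => Set.Finite.image _ ?_) h1
    exact Set.Finite.pi' fun _ => hVfin
  have hv₀N : v₀.steps ≤ N := by
    have h1 : (v₀.steps : ℝ) ≤ riemannCost f v₀ / A := by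
      rw [le_div_iff₀ hA0]; exact hlow v₀ hv₀
    exact_mod_cast h1.trans (Nat.le_ceil _)
  obtain ⟨y, hyS, hymin⟩ := Set.exists_min_image S id hSfin ⟨_, v₀, ⟨hv₀, hv₀N⟩, rfl⟩
  refine ⟨y, ?_, ?_⟩
  · obtain ⟨v, hv, rfl⟩ := hyS
    exact ⟨v, hv.1, rfl⟩
  · rintro _ ⟨v, hv, rfl⟩
    rcases le_or_gt v.steps N with hle | hgt
    · exact hymin _ ⟨v, ⟨hv, hle⟩, rfl⟩
    · refine (hymin _ ⟨v₀, ⟨hv₀, hv₀N⟩, rfl⟩).trans (le_trans ?_ (hlow v hv))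
      have h1 : riemannCost f v₀ / A ≤ v.steps :=
        (Nat.le_ceil _).trans (by exact_mod_cast hgt.le)
      rwa [div_le_iff₀ hA0] at h1

/-- Any path between distinct points is asymptotically matched by paths in the `ε`-graphs. -/
theorem eventually_exists_graphPath_of_ne (h : CostBounds D p f m₁ m₂ c) {x : ℕ → Euc d}
    (hx : ∀ i, x i ∈ D) {ε : ℕ → ℝ} (hεpos : ∀ᶠ n in atTop, 0 < ε n)
    (hε : Tendsto ε atTop (𝓝 0))
    (hcover : ∀ κ > 0, ∀ᶠ n in atTop, ∀ y ∈ D, ∃ i < n, dist (x i) y < κ * ε n)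
    {a b : Euc d} (hab : a ≠ b) {γ : ℝ → Euc d} (hγ : γ ∈ lipPaths D a b) {τ : ℝ} (hτ : 0 < τ) :
    ∀ᶠ n in atTop, ∃ v ∈ graphPaths x n (ε n) a b, riemannCost f v ≤ pathCost f γ + τ := by
  obtain ⟨K, γ', hK, hD, heq, h0, h1⟩ := exists_extension_of_mem_lipPaths hγ
  rw [← pathCost_congr f heq]
  clear heq hγ γ
  have hK0 : (0 : ℝ) ≤ K := K.2
  have huc : UniformContinuousOn (fun z : Euc d × Euc d => f z.1 z.2)
      (D ×ˢ Metric.closedBall 0 ((K : ℝ) + 1)) :=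
    (h.isCompact.prod (isCompact_closedBall _ _)).uniformContinuousOn_of_continuous
      (h.continuousOn.mono (prod_mono_right (subset_univ _)))
  obtain ⟨θ, hθ, hf⟩ := Metric.uniformContinuousOn_iff.1 huc (τ / 2) (half_pos hτ)
  -- Moving vertices by less than `κ * ε n` changes velocities by at most `2 * (2 * K + 3) * κ`,
  -- because `m * ε n ≤ 2 * K + 3` below. This must stay under both `θ` and `1`, the latter to
  -- remain in the ball of radius `K + 1`.
  set κ := min θ 1 / (4 * (2 * K + 3)) with hκ
  have hκ0 : 0 < κ := div_pos (lt_min hθ one_pos) (by positivity)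
  have hκ' : 4 * (2 * K + 3) * κ = min θ 1 := by rw [hκ]; field_simp
  have hκθ : 4 * (2 * K + 3) * κ ≤ θ := hκ'.trans_le (min_le_left _ _)
  have hκ1 : 4 * (2 * K + 3) * κ ≤ 1 := hκ'.trans_le (min_le_right _ _)
  have hKκ : 0 ≤ K * κ := by positivity
  have t1 : Tendsto (fun n => c * (K : ℝ) ^ (p + 1) * ε n) atTop (𝓝 0) := by
    simpa using hε.const_mul (c * (K : ℝ) ^ (p + 1))
  filter_upwards [hεpos, hε.eventually_le_const one_pos, t1.eventually_le_const (half_pos hτ),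
    hcover κ hκ0] with n hn hn1 hnτ hnc
  -- Steps of the sampled path then have length `K / m ≤ ε n / 2`, leaving room for the displacement
  -- of the vertices, while `m * ε n` stays bounded.
  set m := ⌈(2 * K + 2) / ε n⌉₊ with hmdef
  have hmlow : (2 * K + 2) ≤ m * ε n := by
    rw [← div_le_iff₀ hn]; exact Nat.le_ceil _
  have hmup : m * ε n ≤ 2 * K + 3 := by
    have := (Nat.ceil_lt_add_one (show 0 ≤ (2 * K + 2) / ε n by positivity)).le
    rw [← hmdef] at this
    calc m * ε n ≤ ((2 * K + 2) / ε n + 1) * ε n := by gcongr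
      _ = 2 * K + 2 + ε n := by field_simp
      _ ≤ _ := by linarith
  have hm : 1 ≤ m := Nat.ceil_pos.2 (by positivity)
  have hm0 : (0 : ℝ) < m := by exact_mod_cast hm
  have hpt : ∀ i : ℕ, ∃ y, y ∈ graphVertices x n a b ∧ (i = 0 → y = a) ∧ (i = m → y = b) ∧
      dist y (γ' ((i : ℝ) / m)) < κ * ε n := by
    intro i
    by_cases hi0 : i = 0
    · subst hi0
      refine ⟨a, Or.inr (by simp), fun _ => rfl, fun h' => by omega, ?_⟩
      simp [h0]; positivity
    · by_cases him : i = m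
      · refine ⟨b, Or.inr (by simp), fun h' => by omega, fun _ => rfl, ?_⟩
        simp [him, div_self hm0.ne', h1]; positivity
      · obtain ⟨j, hj, hj'⟩ := hnc _ (hD ((i : ℝ) / m))
        exact ⟨x j, Or.inl ⟨j, hj, rfl⟩, fun h' => absurd h' hi0, fun h' => absurd h' him, hj'⟩
  choose u huV hu0 hum hud using hpt
  have ha : a ∈ D := by rw [← h0]; exact hD _
  have hb : b ∈ D := by rw [← h1]; exact hD _
  have huD : ∀ i, u i ∈ D := fun i => graphVertices_subset hx ha hb n (huV i)
  have hγstep : ∀ i : ℕ, ‖γ' (((i + 1 : ℕ) : ℝ) / m) - γ' ((i : ℝ) / m)‖ ≤ K * (1 / m) :=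
    fun i => by
    rw [← dist_eq_norm]
    refine (hK.dist_le_mul _ _).trans (le_of_eq ?_)
    rw [Real.dist_eq, uniform_knots_sub, abs_of_pos (by positivity)]
  have hdiff : ∀ i : ℕ, ‖(u (i + 1) - u i) - (γ' (((i + 1 : ℕ) : ℝ) / m) - γ' ((i : ℝ) / m))‖ ≤
      2 * (κ * ε n) := fun i => by
    have e1 := (hud i).le
    have e2 := (hud (i + 1)).le
    rw [dist_eq_norm] at e1 e2
    rw [sub_sub_sub_comm]
    exact (norm_sub_le _ _).trans (by linarith)
  have hstep : ∀ i : ℕ, dist (u i) (u (i + 1)) < ε n := fun i => by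
    rw [dist_comm, dist_eq_norm]
    have e1 := norm_le_norm_add_norm_sub' (u (i + 1) - u i)
      (γ' (((i + 1 : ℕ) : ℝ) / m) - γ' ((i : ℝ) / m))
    have e2 := hγstep i
    have e3 := hdiff i
    have e4 : K * (1 / m) ≤ ε n / 2 := by
      rw [mul_one_div, div_le_iff₀ hm0]
      linarith
    have e5 : κ * ε n ≤ 1 / 12 * ε n := by gcongr; linarith
    linarith
  have hcost : riemannCost f ⟨m, u⟩ ≤ riemannCost f (samplePath γ' m) + τ / 2 := by
    have e0 : ∀ i ∈ Finset.range m, f (u i) ((m : ℝ) • (u (i + 1) - u i)) ≤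
        f (γ' ((i : ℝ) / m)) ((m : ℝ) • (γ' (((i + 1 : ℕ) : ℝ) / m) - γ' ((i : ℝ) / m))) + τ / 2 := by
      intro i _
      have e1 : ‖(m : ℝ) • (γ' (((i + 1 : ℕ) : ℝ) / m) - γ' ((i : ℝ) / m))‖ ≤ K := by
        rw [norm_smul, Real.norm_natCast]
        calc (m : ℝ) * _ ≤ m * (K * (1 / m)) := by gcongr; exact hγstep i
          _ = K := by field_simp
      have e2 : ‖(m : ℝ) • (u (i + 1) - u i) -
          (m : ℝ) • (γ' (((i + 1 : ℕ) : ℝ) / m) - γ' ((i : ℝ) / m))‖ ≤ 2 * (2 * K + 3) * κ := by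
        rw [← smul_sub, norm_smul, Real.norm_natCast]
        calc (m : ℝ) * _ ≤ m * (2 * (κ * ε n)) := by gcongr; exact hdiff i
          _ = 2 * κ * (m * ε n) := by ring
          _ ≤ 2 * κ * (2 * K + 3) := by gcongr
          _ = _ := by ring
      have e3 := norm_le_norm_add_norm_sub' ((m : ℝ) • (u (i + 1) - u i))
        ((m : ℝ) • (γ' (((i + 1 : ℕ) : ℝ) / m) - γ' ((i : ℝ) / m)))
      have e4 : κ * ε n ≤ κ := mul_le_of_le_one_right hκ0.le hn1
      have e5 := hf (u i, (m : ℝ) • (u (i + 1) - u i))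
        ⟨huD i, mem_closedBall_zero_iff.2 (by linarith)⟩
        (γ' ((i : ℝ) / m), (m : ℝ) • (γ' (((i + 1 : ℕ) : ℝ) / m) - γ' ((i : ℝ) / m)))
        ⟨hD _, mem_closedBall_zero_iff.2 (by linarith)⟩
        (by
          rw [Prod.dist_eq]
          refine max_lt ((hud i).trans_le (by linarith)) ?_
          rw [dist_eq_norm]
          refine e2.trans_lt ?_
          linarith)
      rw [Real.dist_eq] at e5
      linarith [(abs_lt.1 e5).2]
    have e1 := Finset.sum_le_sum e0
    rw [Finset.sum_add_distrib, Finset.sum_const, Finset.card_range, nsmul_eq_mul] at e1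
    have e2 := mul_le_mul_of_nonneg_left e1 (show 0 ≤ 1 / (m : ℝ) by positivity)
    rw [mul_add, ← mul_assoc _ (m : ℝ), one_div_mul_cancel hm0.ne', one_mul] at e2
    exact e2
  have hu0' := hu0 0 rfl
  have hum' := hum m rfl
  -- Neighbouring sample times may select the same vertex, and the graph forbids loops.
  obtain ⟨w, hw, hw0, hw1, hne, hedge, hle⟩ := h.exists_dedup_riemannCost_le ⟨m, u⟩
    (fun i _ => huD _) (by
      change u 0 ≠ u m
      rwa [hu0', hum'])
  refine ⟨w, ⟨hw, hw0.trans hu0', hw1.trans hum', fun i hi => ?_⟩, ?_⟩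
  · obtain ⟨j, -, e1, e2⟩ := hedge i hi
    refine ⟨?_, ?_, dist_pos.2 (hne i hi), ?_⟩
    · rw [e1]; exact huV j
    · rw [e2]; exact huV (j + 1)
    · rw [e1, e2]; exact hstep j
  · have e1 := h.riemannCost_samplePath_le hK hD hm
    have e2 : c * K ^ (p + 1) / m ≤ c * (K : ℝ) ^ (p + 1) * ε n := by
      have := h.c_nonneg
      rw [div_le_iff₀ hm0, mul_assoc]
      exact le_mul_of_one_le_right (by positivity) (by linarith)
    linarith

/-- A path from `a` to `a` cannot stay put, so it makes a detour through one sample point, of cost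
`O(ε ^ p)`. Convexity gives a point of `D` at distance `ε / 2` from `a`; a sample within `ε / 4` of
it differs from `a` and is adjacent to it. -/
theorem eventually_exists_graphPath_self (h : CostBounds D p f m₁ m₂ c) {x : ℕ → Euc d}
    (hx : ∀ i, x i ∈ D) {ε : ℕ → ℝ} (hεpos : ∀ᶠ n in atTop, 0 < ε n)
    (hε : Tendsto ε atTop (𝓝 0))
    (hcover : ∀ κ > 0, ∀ᶠ n in atTop, ∀ y ∈ D, ∃ i < n, dist (x i) y < κ * ε n)
    (hDnt : D.Nontrivial) {a : Euc d} (ha : a ∈ D) {τ : ℝ} (hτ : 0 < τ) :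
    ∀ᶠ n in atTop, ∃ v ∈ graphPaths x n (ε n) a a, riemannCost f v ≤ τ := by
  obtain ⟨z, hz, hza⟩ := hDnt.exists_ne a
  have hza' : 0 < ‖z - a‖ := norm_pos_iff.2 (sub_ne_zero.2 hza)
  have hp := h.p_pos
  have t1 : Tendsto (fun n => (2 : ℝ) ^ (p - 1) * (2 * (m₂ * ε n ^ p))) atTop (𝓝 0) := by
    have := (hε.rpow_const (p := p) (Or.inr hp.le))
    rw [Real.zero_rpow hp.ne'] at this
    simpa using ((this.const_mul m₂).const_mul 2).const_mul ((2 : ℝ) ^ (p - 1))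
  filter_upwards [hεpos, hε.eventually_le_const (u := 2 * ‖z - a‖) (by positivity),
    t1.eventually_le_const hτ, hcover (1 / 4) (by norm_num)] with n hn hn1 hnτ hnc
  set s := ε n / (2 * ‖z - a‖) with hs
  have hy : a + s • (z - a) ∈ D :=
    h.convexDomain.add_smul_sub_mem ha hz
      ⟨by positivity, by rw [hs, div_le_one (by positivity)]; exact hn1⟩
  have hya : dist (a + s • (z - a)) a = ε n / 2 := by
    rw [dist_eq_norm, add_sub_cancel_left, norm_smul, Real.norm_of_nonneg (by positivity), hs]
    field_simp
  obtain ⟨i, hi, hiy⟩ := hnc _ hy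
  have hlt : dist (x i) a < ε n := by
    have := dist_triangle (x i) (a + s • (z - a)) a
    linarith
  have hpos : 0 < dist (x i) a := by
    have := dist_triangle_left (a + s • (z - a)) a (x i)
    linarith
  have hxV : x i ∈ graphVertices x n a a := Or.inl ⟨i, hi, rfl⟩
  have haV : a ∈ graphVertices x n a a := Or.inr (by simp)
  refine ⟨⟨2, fun j => if j = 1 then x i else a⟩, ⟨by norm_num, by simp, by simp, ?_⟩, ?_⟩
  · intro j hj
    dsimp only at hj ⊢
    interval_cases j
    · exact ⟨haV, hxV, by simpa [dist_comm] using hpos, by simpa [dist_comm] using hlt⟩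
    · exact ⟨hxV, haV, by simpa using hpos, by simpa using hlt⟩
  · rw [h.riemannCost_eq (by norm_num) fun j _ => by dsimp only; split_ifs <;> simp [hx, ha]]
    refine le_trans ?_ hnτ
    simp only [Finset.sum_range_succ, Finset.sum_range_zero]
    norm_num
    rw [dist_eq_norm] at hlt
    have e1 := h.le_of_norm_le ha (K := ε n) hlt.le
    have e2 := h.le_of_norm_le (hx i) (v := a - x i) (K := ε n) (by rw [norm_sub_rev]; exact hlt.le)
    exact mul_le_mul_of_nonneg_left (by linarith) (by positivity)

theorem eventually_exists_graphPath (h : CostBounds D p f m₁ m₂ c) {x : ℕ → Euc d}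
    (hx : ∀ i, x i ∈ D) {ε : ℕ → ℝ} (hεpos : ∀ᶠ n in atTop, 0 < ε n)
    (hε : Tendsto ε atTop (𝓝 0))
    (hcover : ∀ κ > 0, ∀ᶠ n in atTop, ∀ y ∈ D, ∃ i < n, dist (x i) y < κ * ε n)
    (hDnt : D.Nontrivial) {a b : Euc d} (ha : a ∈ D) {γ : ℝ → Euc d}
    (hγ : γ ∈ lipPaths D a b) {τ : ℝ} (hτ : 0 < τ) :
    ∀ᶠ n in atTop, ∃ v ∈ graphPaths x n (ε n) a b, riemannCost f v ≤ pathCost f γ + τ := by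
  rcases eq_or_ne a b with rfl | hab
  · filter_upwards [h.eventually_exists_graphPath_self hx hεpos hε hcover hDnt ha hτ] with n hn
    obtain ⟨v, hv, hle⟩ := hn
    exact ⟨v, hv, hle.trans (le_add_of_nonneg_left (h.pathCost_nonneg hγ))⟩
  · exact h.eventually_exists_graphPath_of_ne hx hεpos hε hcover hab hγ hτ

end CostBounds
end GeodesicApprox

/-! ### Convergence of discrete minimizers for a fixed dense sequence -/

namespace GeodesicApprox

variable {d : ℕ}

theorem eventually_atTop_of_forall_subseq {P : ℕ → Prop}
    (H : ∀ φ : ℕ → ℕ, StrictMono φ → ∃ ψ : ℕ → ℕ, StrictMono ψ ∧ ∀ᶠ k in atTop, P (φ (ψ k))) :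
    ∀ᶠ n in atTop, P n := by
  by_contra hP
  obtain ⟨φ, hφ, h⟩ := extraction_of_frequently_atTop (not_eventually.1 hP)
  obtain ⟨ψ, -, hψ⟩ := H φ hφ
  obtain ⟨k, hk⟩ := hψ.exists
  exact h _ hk

theorem ConvergesTo.congr {v : ℕ → DiscretePath d} {γ η : ℝ → Euc d} (hv : ConvergesTo v γ)
    (heq : EqOn γ η (Icc 0 1)) : ConvergesTo v η :=
  ⟨hv.1.congr_right heq, by rw [← heq.image_eq]; exact hv.2⟩

theorem convergesTo_of_forall_subseq {v : ℕ → DiscretePath d} {γ : ℝ → Euc d}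
    (H : ∀ φ : ℕ → ℕ, StrictMono φ → ∃ ψ : ℕ → ℕ, StrictMono ψ ∧
      ConvergesTo (fun k => v (φ (ψ k))) γ) : ConvergesTo v γ := by
  constructor
  · rw [Metric.tendstoUniformlyOn_iff]
    intro e he
    refine eventually_atTop_of_forall_subseq fun φ hφ => ?_
    obtain ⟨ψ, hψ, h⟩ := H φ hφ
    exact ⟨ψ, hψ, Metric.tendstoUniformlyOn_iff.1 h.1 e he⟩
  · rw [Metric.tendsto_nhds]
    intro e he
    refine eventually_atTop_of_forall_subseq fun φ hφ => ?_
    obtain ⟨ψ, hψ, h⟩ := H φ hφ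
    exact ⟨ψ, hψ, Metric.tendsto_nhds.1 h.2 e he⟩

/-- Vertices are values of the interpolation at the times `i / m`, and each point of the
interpolation is within one edge of a vertex. -/
theorem hausdorffDist_points_le {v : DiscretePath d} (hm : 1 ≤ v.steps) {δ e : ℝ}
    (hδ : ∀ i < v.steps, ‖v.vertex (i + 1) - v.vertex i‖ ≤ δ) {γ : ℝ → Euc d}
    (he : ∀ t ∈ Icc (0 : ℝ) 1, dist (linInterp v t) (γ t) ≤ e) :
    Metric.hausdorffDist v.points (γ '' Icc 0 1) ≤ e + δ := by
  have hm0 : (0 : ℝ) < v.steps := by exact_mod_cast hm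
  have hδ0 : 0 ≤ δ := (norm_nonneg _).trans (hδ 0 hm)
  have he0 : 0 ≤ e := dist_nonneg.trans (he 0 ⟨le_rfl, zero_le_one⟩)
  refine Metric.hausdorffDist_le_of_mem_dist (by positivity) ?_ ?_
  · rintro _ ⟨i, hi, rfl⟩
    have hmem : (i : ℝ) / v.steps ∈ Icc (0 : ℝ) 1 :=
      ⟨by positivity, by rw [div_le_one hm0]; exact_mod_cast hi⟩
    refine ⟨_, mem_image_of_mem γ hmem, ?_⟩
    have h1 : linInterp v ((i : ℝ) / v.steps) = v.vertex i := by
      rw [linInterp_eqOn_polygon v hm hmem]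
      exact polygon_knot hm (strictMonoOn_uniform_knots hm) _ hi
    rw [← h1]
    exact (he _ hmem).trans (by linarith)
  · rintro _ ⟨t, ht, rfl⟩
    obtain ⟨i, hi, hit⟩ := exists_mem_Icc_knots hm (fun i : ℕ => (i : ℝ) / v.steps) (t := t)
      (by simpa using ht.1) (by simpa [div_self hm0.ne'] using ht.2)
    refine ⟨v.vertex i, ⟨i, hi.le, rfl⟩, ?_⟩
    have h1 : dist (linInterp v t) (v.vertex i) ≤ δ := by
      have h2 := sub_nonneg.2 hit.1
      have h3 := uniform_knots_sub v.steps i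
      rw [linInterp_eqOn_polygon v hm ht,
        polygon_eq (strictMonoOn_uniform_knots hm) v.vertex hi hit, dist_eq_norm,
        add_sub_cancel_left, norm_smul]
      refine (mul_le_of_le_one_left (norm_nonneg _) ?_).trans (hδ i hi)
      rw [h3, Real.norm_of_nonneg (by positivity), div_le_one (by positivity)]
      linarith [hit.2]
    have h2 := dist_triangle_left (γ t) (v.vertex i) (linInterp v t)
    linarith [he t ht]

/-- A non-degenerate discrete path in `D` from `a` to `b` with steps of length at most `δ`. -/
structure DiscretePath.IsFine (v : DiscretePath d) (D : Set (Euc d)) (a b : Euc d) (δ : ℝ) :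
    Prop where
  one_le_steps : 1 ≤ v.steps
  mem : ∀ i ≤ v.steps, v.vertex i ∈ D
  first : v.vertex 0 = a
  last : v.vertex v.steps = b
  ne : ∀ i < v.steps, v.vertex i ≠ v.vertex (i + 1)
  norm_le : ∀ i < v.steps, ‖v.vertex (i + 1) - v.vertex i‖ ≤ δ

theorem DiscretePath.IsFine.nonneg {v : DiscretePath d} {D : Set (Euc d)} {a b : Euc d} {δ : ℝ}
    (hv : v.IsFine D a b δ) : 0 ≤ δ := (norm_nonneg _).trans (hv.norm_le 0 hv.one_le_steps)

theorem isFine_of_mem_graphPaths {D : Set (Euc d)} {x : ℕ → Euc d} (hx : ∀ i, x i ∈ D)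
    {a b : Euc d} (ha : a ∈ D) (hb : b ∈ D) {n : ℕ} {ε : ℝ} {v : DiscretePath d}
    (hv : v ∈ graphPaths x n ε a b) : v.IsFine D a b ε where
  one_le_steps := hv.1
  mem _ hi := graphVertices_subset hx ha hb n (graphPaths_vertex_mem hv hi)
  first := hv.2.1
  last := hv.2.2.1
  ne i hi := dist_pos.1 (hv.2.2.2 i hi).2.2.1
  norm_le i hi := by
    rw [← dist_eq_norm, dist_comm]
    exact (hv.2.2.2 i hi).2.2.2.le

theorem tendsto_one_add_mul_div (c m₁ : ℝ) {δ : ℕ → ℝ}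
    (hδ : Tendsto δ atTop (𝓝 0)) : Tendsto (fun n => 1 + c * δ n / m₁) atTop (𝓝 1) := by
  simpa using ((hδ.const_mul c).div_const m₁).const_add 1

namespace CostBounds

variable {D : Set (Euc d)} {p : ℝ} {f : Euc d → Euc d → ℝ} {m₁ m₂ c : ℝ}

/-- The lower bound in the Γ-convergence argument: the interpolation is itself an admissible path.
-/
theorem argmin_le_riemannCost (h : CostBounds D p f m₁ m₂ c) {a b : Euc d} {γ : ℝ → Euc d}
    (hγ : γ ∈ argminOn (pathCost f) (lipPaths D a b)) {v : DiscretePath d} {δ : ℝ}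
    (hv : v.IsFine D a b δ) : pathCost f γ ≤ (1 + c * δ / m₁) * riemannCost f v := by
  have h1 := linInterp_mem_lipPaths h.convexDomain hv.one_le_steps hv.mem
  rw [hv.first, hv.last] at h1
  have h2 := abs_le.1 (h.abs_pathCost_linInterp_sub_le hv.one_le_steps hv.mem hv.norm_le)
  linarith [hγ.2 _ h1, h2.2]

/-- Almost minimizing discrete paths of vanishing mesh converge to a minimizer, up to extraction:
version in which the assumptions hold for all indices. -/
theorem exists_subseq_convergesTo_of_forall (h : CostBounds D p f m₁ m₂ c) {a b : Euc d}
    {γ₀ : ℝ → Euc d} (hγ₀ : γ₀ ∈ argminOn (pathCost f) (lipPaths D a b))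
    {w : ℕ → DiscretePath d} {δ : ℕ → ℝ} (hδ : Tendsto δ atTop (𝓝 0))
    (hw : ∀ n, (w n).IsFine D a b (δ n))
    (hle : ∀ n, riemannCost f (w n) ≤ pathCost f γ₀ + 1)
    (hlim : Tendsto (fun n => riemannCost f (w n)) atTop (𝓝 (pathCost f γ₀))) :
    ∃ ψ : ℕ → ℕ, StrictMono ψ ∧ ∃ γ ∈ argminOn (pathCost f) (lipPaths D a b),
      ConvergesTo (fun k => w (ψ k)) γ := by
  set M := pathCost f γ₀ with hM
  have hM0 : 0 ≤ M := h.pathCost_nonneg hγ₀.1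
  have hp := h.p_pos
  have hm₁ := h.m₁_pos
  have hm₂ := h.m₂_pos
  have hc := h.c_nonneg
  choose L K η hL hK hη hηD hη0 hη1 hLH hηF hdist using fun n =>
    h.exists_reparametrization (hw n).one_le_steps (hw n).mem (hw n).ne (hw n).norm_le
  set r := m₁ ^ (1 / p) with hr
  have hr0 : 0 < r := Real.rpow_pos_of_pos hm₁ _
  have hLroot : ∀ n, L n = (L n ^ p) ^ (1 / p) := fun n => by
    rw [← Real.rpow_mul (hL n).le, mul_one_div_cancel hp.ne', Real.rpow_one]
  set B : ℝ := (M + 1) ^ (1 / p) / r with hB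
  have hB0 : 0 ≤ B := by positivity
  have hKB : ∀ n, (K n : ℝ) ≤ B := fun n => by
    rw [hK, hLroot]
    exact div_le_div_of_nonneg_right (Real.rpow_le_rpow (by have := hL n; positivity)
      ((hLH n).trans (hle n)) (by positivity)) hr0.le
  have hηK : ∀ n, LipschitzWith B.toNNReal (η n) := fun n => (hη n).weaken <| by
    rw [← NNReal.coe_le_coe, Real.coe_toNNReal _ hB0]
    exact hKB n
  have hηΩ : ∀ n, η n ∈ lipPaths D a b := fun n => by
    have := mem_lipPaths (hη n) (hηD n)
    rwa [hη0, hη1, (hw n).first, (hw n).last] at this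
  have hfac := tendsto_one_add_mul_div c m₁ hδ
  have hfac1 : ∀ n, 1 ≤ 1 + c * δ n / m₁ := fun n => by
    have := (hw n).nonneg
    have : 0 ≤ c * δ n / m₁ := by positivity
    linarith
  have hup : Tendsto (fun n => (1 + c * δ n / m₁) * riemannCost f (w n)) atTop (𝓝 M) := by
    simpa using hfac.mul hlim
  -- Minimality of `M` and the power mean inequality squeeze `L n ^ p` between quantities tending to
  -- `M`, so that inequality becomes sharp in the limit.
  have hLfac : Tendsto (fun n => (1 + c * δ n / m₁) * L n ^ p) atTop (𝓝 M) :=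
    tendsto_of_tendsto_of_tendsto_of_le_of_le tendsto_const_nhds hup
      (fun n => (hγ₀.2 _ (hηΩ n)).trans (hηF n))
      (fun n => mul_le_mul_of_nonneg_left (hLH n) (by linarith [hfac1 n]))
  have hLlim : Tendsto (fun n => L n ^ p) atTop (𝓝 M) := by
    have := hLfac.div hfac one_ne_zero
    rw [div_one] at this
    refine this.congr fun n => ?_
    have := hfac1 n
    exact mul_div_cancel_left₀ _ (by positivity)
  have hFlim : Tendsto (fun n => pathCost f (η n)) atTop (𝓝 M) :=
    tendsto_of_tendsto_of_tendsto_of_le_of_le tendsto_const_nhds hLfac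
      (fun n => hγ₀.2 _ (hηΩ n)) hηF
  obtain ⟨ψ, hψ, γ, hγ, hγM, hunif⟩ := h.exists_subseq_limit hηK hηD
    (fun n => (hη0 n).trans (hw n).first) (fun n => (hη1 n).trans (hw n).last) hFlim
  have hclose : ∀ e > 0, ∀ᶠ n in atTop, ∀ t ∈ Icc (0 : ℝ) 1,
      dist (linInterp (w n) t) (η n t) < e := by
    intro e he
    have hδ' : Tendsto (fun n => (1 + m₂ ^ (1 / p) / r) * δ n) atTop (𝓝 0) := by
      simpa using hδ.const_mul (1 + m₂ ^ (1 / p) / r)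
    -- If `M = 0`, the ratio `riemannCost f (w n) / L n ^ p` need not tend to `1`, but the Lipschitz
    -- constants tend to zero and the crude distance estimate suffices.
    rcases hM0.eq_or_lt with h0 | hMpos
    · have hKlim : Tendsto (fun n => (K n : ℝ)) atTop (𝓝 0) := by
        have h1 := (hLlim.rpow_const (p := 1 / p) (Or.inr (by positivity))).div_const r
        rw [← h0, Real.zero_rpow (by positivity), zero_div] at h1
        exact h1.congr fun n => by rw [hK, ← hLroot]
      have h2 := hδ'.add hKlim
      rw [add_zero] at h2
      filter_upwards [h2.eventually_lt_const he] with n hn t ht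
      exact ((hdist n t ht).1).trans_lt hn
    · obtain ⟨C, hC, hgap⟩ := exists_abs_sub_one_le_rpow_gap h.one_lt
        (show 0 < e / (2 * (B + 1)) by positivity)
      have h1 : Tendsto (fun n => riemannCost f (w n) / L n ^ p - 1) atTop (𝓝 0) := by
        simpa [div_self hMpos.ne'] using (hlim.div hLlim hMpos.ne').sub_const 1
      have h2 := hδ'.add (((h1.const_mul C).const_add (e / (2 * (B + 1)))).const_mul B)
      have h3 : 0 + B * (e / (2 * (B + 1)) + C * 0) < e := by
        have : B * (e / (2 * (B + 1))) ≤ e / 2 := by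
          rw [mul_div_assoc', div_le_div_iff₀ (by positivity) two_pos]
          nlinarith
        linarith
      filter_upwards [h2.eventually_lt_const h3] with n hn t ht
      refine ((hdist n t ht).2 _ C hC.le hgap).trans_lt (lt_of_le_of_lt ?_ hn)
      have h4 : 0 ≤ riemannCost f (w n) / L n ^ p - 1 := by
        rw [sub_nonneg, one_le_div (by have := hL n; positivity)]
        exact hLH n
      gcongr
      exact hKB n
  have hconv : ∀ e > 0, ∀ᶠ k in atTop, ∀ t ∈ Icc (0 : ℝ) 1,
      dist (linInterp (w (ψ k)) t) (γ t) < e := by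
    intro e he
    filter_upwards [hψ.tendsto_atTop.eventually (hclose (e / 2) (half_pos he)),
      Metric.tendstoUniformlyOn_iff.1 hunif (e / 2) (half_pos he)] with k h1 h2 t ht
    have h3 := h1 t ht
    have h4 := h2 t ht
    rw [dist_comm] at h4
    linarith [dist_triangle (linInterp (w (ψ k)) t) (η (ψ k) t) (γ t)]
  refine ⟨ψ, hψ, γ, ⟨hγ, fun ξ hξ => hγM.trans (hγ₀.2 ξ hξ)⟩, ?_, ?_⟩
  · rw [Metric.tendstoUniformlyOn_iff]
    intro e he
    filter_upwards [hconv e he] with k hk t ht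
    rw [dist_comm]
    exact hk t ht
  · rw [Metric.tendsto_nhds]
    intro e he
    filter_upwards [hconv (e / 2) (half_pos he),
      (hδ.comp hψ.tendsto_atTop).eventually_lt_const (half_pos he)] with k h1 h2
    rw [Real.dist_0_eq_abs, abs_of_nonneg Metric.hausdorffDist_nonneg]
    have h3 := hausdorffDist_points_le (hw (ψ k)).one_le_steps (hw (ψ k)).norm_le
      fun t ht => (h1 t ht).le
    dsimp only [Function.comp] at h2
    linarith

theorem exists_subseq_convergesTo (h : CostBounds D p f m₁ m₂ c) {a b : Euc d}
    {γ₀ : ℝ → Euc d} (hγ₀ : γ₀ ∈ argminOn (pathCost f) (lipPaths D a b))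
    {w : ℕ → DiscretePath d} {δ : ℕ → ℝ} (hδ : Tendsto δ atTop (𝓝 0))
    (hw : ∀ᶠ n in atTop, (w n).IsFine D a b (δ n))
    (hlim : Tendsto (fun n => riemannCost f (w n)) atTop (𝓝 (pathCost f γ₀))) :
    ∃ ψ : ℕ → ℕ, StrictMono ψ ∧ ∃ γ ∈ argminOn (pathCost f) (lipPaths D a b),
      ConvergesTo (fun k => w (ψ k)) γ := by
  obtain ⟨N, hN⟩ := eventually_atTop.1
    (hw.and (hlim.eventually_le_const (lt_add_one (pathCost f γ₀))))
  obtain ⟨ψ, hψ, γ, hγ, hconv⟩ := h.exists_subseq_convergesTo_of_forall hγ₀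
    (hδ.comp (tendsto_add_atTop_nat N)) (fun n => (hN (n + N) (by omega)).1)
    (fun n => (hN (n + N) (by omega)).2) (hlim.comp (tendsto_add_atTop_nat N))
  exact ⟨fun k => ψ k + N, fun i j hij => Nat.add_lt_add_right (hψ hij) N, γ, hγ, hconv⟩

/-- The convergence result for a deterministic sequence of points that fills `D` at a scale
smaller than `ε`. -/
theorem convergence_of_covering (h : CostBounds D p f m₁ m₂ c) (hDnt : D.Nontrivial)
    {a b : Euc d} (ha : a ∈ D) (hb : b ∈ D) {x : ℕ → Euc d} (hx : ∀ i, x i ∈ D) {ε : ℕ → ℝ}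
    (hεpos : ∀ᶠ n in atTop, 0 < ε n) (hε : Tendsto ε atTop (𝓝 0))
    (hcover : ∀ κ > 0, ∀ᶠ n in atTop, ∀ y ∈ D, ∃ i < n, dist (x i) y < κ * ε n)
    {γ₀ : ℝ → Euc d} (hγ₀ : γ₀ ∈ argminOn (pathCost f) (lipPaths D a b)) :
    (∃ minH : ℕ → ℝ,
      (∀ᶠ n in atTop, IsLeast (riemannCost f '' graphPaths x n (ε n) a b) (minH n)) ∧
      Tendsto minH atTop (𝓝 (pathCost f γ₀))) ∧
    ∀ w : ℕ → DiscretePath d,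
      (∀ᶠ n in atTop, w n ∈ argminOn (riemannCost f) (graphPaths x n (ε n) a b)) →
      (∀ φ : ℕ → ℕ, StrictMono φ → ∃ ψ : ℕ → ℕ, StrictMono ψ ∧
        ∃ γ ∈ argminOn (pathCost f) (lipPaths D a b),
          ConvergesTo (fun k => w (φ (ψ k))) γ) ∧
      (∀ γ ∈ argminOn (pathCost f) (lipPaths D a b),
        (∀ η ∈ argminOn (pathCost f) (lipPaths D a b), EqOn η γ (Icc 0 1)) →
        ConvergesTo w γ) := by
  set M := pathCost f γ₀ with hM
  have hm₁ := h.m₁_pos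
  have hc := h.c_nonneg
  have hfac := tendsto_one_add_mul_div c m₁ hε
  have hrec : ∀ τ > 0, ∀ᶠ n in atTop, ∃ v ∈ graphPaths x n (ε n) a b, riemannCost f v ≤ M + τ :=
    fun τ hτ => h.eventually_exists_graphPath hx hεpos hε hcover hDnt ha hγ₀.1 hτ
  have hlim : ∀ y : ℕ → ℝ,
      (∀ᶠ n in atTop, IsLeast (riemannCost f '' graphPaths x n (ε n) a b) (y n)) →
      Tendsto y atTop (𝓝 M) := by
    intro y hy
    have hlow : Tendsto (fun n => M / (1 + c * ε n / m₁)) atTop (𝓝 M) := by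
      have := (tendsto_const_nhds (x := M)).div hfac one_ne_zero
      rwa [div_one] at this
    refine tendsto_order.2 ⟨fun q hq => ?_, fun q hq => ?_⟩
    · filter_upwards [hlow.eventually_const_lt hq, hy, hεpos] with n h1 h2 h3
      refine h1.trans_le ?_
      obtain ⟨v, hv, hvy⟩ := h2.1
      rw [div_le_iff₀ (by positivity), ← hvy, mul_comm]
      exact h.argmin_le_riemannCost hγ₀ (isFine_of_mem_graphPaths hx ha hb hv)
    · filter_upwards [hrec ((q - M) / 2) (by linarith), hy] with n ⟨v, hv, h1⟩ h2
      have := h2.2 ⟨v, hv, rfl⟩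
      linarith
  refine ⟨⟨fun n => sInf (riemannCost f '' graphPaths x n (ε n) a b), ?_⟩, fun w hw => ?_⟩
  · have h1 : ∀ᶠ n in atTop, IsLeast (riemannCost f '' graphPaths x n (ε n) a b)
        (sInf (riemannCost f '' graphPaths x n (ε n) a b)) := by
      filter_upwards [hrec 1 one_pos] with n ⟨v, hv, _⟩
      obtain ⟨y, hy⟩ := h.exists_isLeast_riemannCost hx ha hb ⟨v, hv⟩
      rwa [hy.csInf_eq]
    exact ⟨h1, hlim _ h1⟩
  · have hwlim : Tendsto (fun n => riemannCost f (w n)) atTop (𝓝 M) := by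
      refine hlim _ ?_
      filter_upwards [hw] with n hn
      refine ⟨⟨w n, hn.1, rfl⟩, ?_⟩
      rintro _ ⟨v, hv, rfl⟩
      exact hn.2 v hv
    have hsub : ∀ φ : ℕ → ℕ, StrictMono φ → ∃ ψ : ℕ → ℕ, StrictMono ψ ∧
        ∃ γ ∈ argminOn (pathCost f) (lipPaths D a b),
          ConvergesTo (fun k => w (φ (ψ k))) γ := fun φ hφ =>
      h.exists_subseq_convergesTo (w := fun k => w (φ k)) hγ₀ (hε.comp hφ.tendsto_atTop)
        (hφ.tendsto_atTop.eventually
          (hw.mono fun n hn => isFine_of_mem_graphPaths hx ha hb hn.1))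
        (hwlim.comp hφ.tendsto_atTop)
    refine ⟨hsub, fun γ hγ huniq => convergesTo_of_forall_subseq fun φ hφ => ?_⟩
    obtain ⟨ψ, hψ, η, hη, hconv⟩ := hsub φ hφ
    exact ⟨ψ, hψ, hconv.congr (huniq η hη)⟩

end CostBounds
end GeodesicApprox

/-! ### Almost sure covering of the domain by the sample -/

namespace GeodesicApprox

variable {d : ℕ}

theorem IsConvexDomain.nontrivial {D : Set (Euc d)} (hD : IsConvexDomain D) (hd : 1 ≤ d) :
    D.Nontrivial := by
  obtain ⟨U, ⟨z, hz⟩, hUo, -, -, rfl⟩ := hD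
  obtain ⟨r, hr, hball⟩ := Metric.isOpen_iff.1 hUo z hz
  refine ⟨z, subset_closure hz, z + EuclideanSpace.single ⟨0, hd⟩ (r / 2),
    subset_closure (hball ?_), ?_⟩
  · rw [Metric.mem_ball, dist_eq_norm, add_sub_cancel_left, PiLp.norm_single,
      Real.norm_of_nonneg (by positivity)]
    exact half_lt_self hr
  · intro h
    have h1 : EuclideanSpace.single (⟨0, hd⟩ : Fin d) (r / 2) = 0 := by simpa using h.symm
    have h2 := congrArg norm h1
    rw [PiLp.norm_single, norm_zero, Real.norm_of_nonneg (by positivity)] at h2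
    linarith

/-- The interior cone property of a convex domain. -/
theorem IsConvexDomain.exists_ball_subset {D : Set (Euc d)} (hD : IsConvexDomain D) :
    ∃ q R : ℝ, 0 < q ∧ 0 < R ∧ ∀ y ∈ D, ∀ r : ℝ, 0 < r → r ≤ R →
      ∃ z, Metric.ball z (q * r) ⊆ D ∩ Metric.ball y r := by
  obtain ⟨U, ⟨z₀, hz₀⟩, hUo, hUb, hUc, rfl⟩ := hD
  obtain ⟨r₀, hr₀, hball⟩ := Metric.isOpen_iff.1 hUo z₀ hz₀
  have hdiam : 0 ≤ Metric.diam (closure U) := Metric.diam_nonneg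
  refine ⟨r₀ / (Metric.diam (closure U) + 1), Metric.diam (closure U) + 1, by positivity,
    by positivity, fun y hy r hr hrR => ?_⟩
  set R := Metric.diam (closure U) + 1 with hR
  have hR0 : 0 < R := by positivity
  have hl : 0 < r / R := by positivity
  -- The homothety centred at `y` with ratio `r / R` carries a fixed ball of `U` into `D` by
  -- convexity, and into `ball y r` because `R` exceeds the diameter.
  refine ⟨y + (r / R) • (z₀ - y), fun w hw => ?_⟩
  set w' := y + (r / R)⁻¹ • (w - y) with hw'
  have hww : w = y + (r / R) • (w' - y) := by
    rw [hw', add_sub_cancel_left, smul_inv_smul₀ hl.ne']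
    abel
  have hw'U : w' ∈ closure U := by
    refine subset_closure (hball ?_)
    have h1 : w - (y + (r / R) • (z₀ - y)) = (r / R) • (w' - z₀) := by
      rw [hww]; module
    rw [Metric.mem_ball, dist_eq_norm, h1, norm_smul, Real.norm_of_nonneg hl.le] at hw
    rw [Metric.mem_ball, dist_eq_norm]
    have h2 : r₀ / R * r = r / R * r₀ := by ring
    rw [h2] at hw
    exact lt_of_mul_lt_mul_left hw hl.le
  constructor
  · rw [hww]
    exact hUc.closure.add_smul_sub_mem hy hw'U ⟨hl.le, by rwa [div_le_one hR0]⟩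
  · rw [Metric.mem_ball, hww, dist_eq_norm, add_sub_cancel_left, norm_smul,
      Real.norm_of_nonneg hl.le, ← dist_eq_norm]
    have h1 := Metric.dist_le_diam_of_mem hUb.closure hw'U hy
    calc r / R * dist w' y ≤ r / R * Metric.diam (closure U) := by gcongr
      _ < r / R * R := by gcongr; linarith
      _ = r := by field_simp

theorem IsConvexDomain.isClosed {D : Set (Euc d)} (hD : IsConvexDomain D) : IsClosed D := by
  obtain ⟨U, -, -, -, -, rfl⟩ := hD
  exact isClosed_closure

/-- A law on a convex domain with density bounded below charges all balls centred in the
domain. -/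
theorem IsConvexDomain.exists_le_withDensity_ball {D : Set (Euc d)} (hD : IsConvexDomain D)
    {ρ : Euc d → ℝ} {c : ℝ} (hc : 0 < c) (hρ : ∀ x ∈ D, c ≤ ρ x) :
    ∃ q R : ℝ, 0 < q ∧ 0 < R ∧ ∀ y ∈ D, ∀ r : ℝ, 0 < r → r ≤ R → ENNReal.ofReal (q * r ^ d) ≤
      (volume.restrict D).withDensity (fun x => ENNReal.ofReal (ρ x)) (Metric.ball y r) := by
  obtain ⟨q, R, hq, hR, h⟩ := hD.exists_ball_subset
  set V : ENNReal := volume (Metric.ball (0 : Euc d) 1) with hV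
  have hVtop : V ≠ ⊤ := measure_ball_lt_top.ne
  have hV0 : 0 < V.toReal := ENNReal.toReal_pos (Metric.measure_ball_pos _ _ one_pos).ne' hVtop
  refine ⟨c * q ^ d * V.toReal, R, by positivity, hR, fun y hy r hr hrR => ?_⟩
  obtain ⟨z, hz⟩ := h y hy r hr hrR
  refine le_trans ?_ (measure_mono (hz.trans inter_subset_right))
  rw [withDensity_apply _ measurableSet_ball, Measure.restrict_restrict measurableSet_ball,
    inter_eq_self_of_subset_left (hz.trans inter_subset_left)]
  calc ENNReal.ofReal (c * q ^ d * V.toReal * r ^ d)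
      = ENNReal.ofReal c * volume (Metric.ball z (q * r)) := by
        rw [Measure.addHaar_ball_of_pos _ _ (by positivity), finrank_euclideanSpace_fin,
          ← hV, ← ENNReal.ofReal_toReal hVtop, ENNReal.toReal_ofReal hV0.le,
          ← ENNReal.ofReal_mul (by positivity), ← ENNReal.ofReal_mul hc.le]
        congr 1
        ring
    _ = ∫⁻ _ in Metric.ball z (q * r), ENNReal.ofReal c := by rw [setLIntegral_const]
    _ ≤ _ := setLIntegral_mono' measurableSet_ball fun x hx =>
        ENNReal.ofReal_le_ofReal (hρ x (hz hx).1)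

/-- A covering of `D` by few balls, when a probability measure charges all balls. -/
theorem exists_finset_cover {D : Set (Euc d)} (ν : Measure (Euc d)) [IsProbabilityMeasure ν]
    {r t : ℝ} (ht : 0 < t)
    (hν : ∀ y ∈ D, ENNReal.ofReal t ≤ ν (Metric.ball y (r / 2))) :
    ∃ S : Finset (Euc d), (∀ s ∈ S, s ∈ D) ∧ (∀ y ∈ D, ∃ s ∈ S, dist y s < r) ∧
      (S.card : ℝ) * t ≤ 1 := by
  classical
  have hcard : ∀ S : Finset (Euc d), (∀ s ∈ S, s ∈ D) →
      (∀ s ∈ S, ∀ s' ∈ S, s ≠ s' → r ≤ dist s s') → (S.card : ℝ) * t ≤ 1 := by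
    intro S hSD hsep
    have hdisj : (S : Set (Euc d)).PairwiseDisjoint fun s => Metric.ball s (r / 2) := by
      intro s hs s' hs' hne
      refine Metric.ball_disjoint_ball ?_
      rw [add_halves]
      exact hsep s hs s' hs' hne
    have h1 := measure_biUnion_finset (μ := ν) hdisj fun _ _ => measurableSet_ball
    have h2 : ∑ _s ∈ S, ENNReal.ofReal t ≤ 1 := by
      refine (Finset.sum_le_sum fun s hs => hν s (hSD s hs)).trans ?_
      rw [← h1]
      exact prob_le_one
    rw [Finset.sum_const, nsmul_eq_mul, ← ENNReal.ofReal_natCast,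
      ← ENNReal.ofReal_mul (Nat.cast_nonneg _), ENNReal.ofReal_le_one] at h2
    exact h2
  by_contra! hno
  -- A separated set satisfies the cardinality bound, since its half-radius balls are disjoint. If
  -- no set as required existed, it would fail to cover and could be enlarged by an uncovered point,
  -- indefinitely.
  have hex : ∀ n : ℕ, ∃ S : Finset (Euc d), S.card = n ∧ (∀ s ∈ S, s ∈ D) ∧
      (∀ s ∈ S, ∀ s' ∈ S, s ≠ s' → r ≤ dist s s') := by
    intro n
    induction n with
    | zero => exact ⟨∅, by simp⟩
    | succ n ih =>
      obtain ⟨S, hSn, hSD, hsep⟩ := ih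
      have : ¬ ∀ y ∈ D, ∃ s ∈ S, dist y s < r := fun hcov =>
        absurd (hcard S hSD hsep) (not_le.2 (hno S hSD hcov))
      push Not at this
      obtain ⟨y, hy, hyS⟩ := this
      by_cases hr : 0 < r
      · have hyn : y ∉ S := fun hy' => by
          have := hyS y hy'
          rw [dist_self] at this
          linarith
        refine ⟨insert y S, by rw [Finset.card_insert_of_notMem hyn, hSn], ?_, ?_⟩
        · intro s hs
          rcases Finset.mem_insert.1 hs with rfl | hs
          · exact hy
          · exact hSD s hs
        · intro s hs s' hs' hne
          rcases Finset.mem_insert.1 hs with rfl | hs1 <;>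
            rcases Finset.mem_insert.1 hs' with rfl | hs1'
          · exact absurd rfl hne
          · exact hyS s' hs1'
          · rw [dist_comm]; exact hyS s hs1
          · exact hsep s hs1 s' hs1' hne
      · have h1 := hν y hy
        rw [Metric.ball_eq_empty.2 (by linarith), measure_empty] at h1
        exact absurd (ENNReal.ofReal_eq_zero.1 (le_antisymm h1 bot_le)) (not_le.2 ht)
  obtain ⟨N, hN⟩ := exists_nat_gt (1 / t)
  obtain ⟨S, hSN, hSD, hsep⟩ := hex N
  have h1 := hcard S hSD hsep
  rw [hSN, ← le_div_iff₀ ht] at h1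
  linarith

theorem ae_mem_domain {Ω : Type*} [MeasurableSpace Ω] {μ : Measure Ω} {X : ℕ → Ω → Euc d}
    {D : Set (Euc d)} (hD : IsConvexDomain D) (hX : ∀ i, Measurable (X i)) {ρ : Euc d → ℝ}
    (hlaw : ∀ i, μ.map (X i) = (volume.restrict D).withDensity (fun x => ENNReal.ofReal (ρ x))) :
    ∀ᵐ ω ∂μ, ∀ i, X i ω ∈ D := by
  refine ae_all_iff.2 fun i => ?_
  refine ae_of_ae_map (hX i).aemeasurable (p := fun y => y ∈ D) ?_
  rw [hlaw i]
  exact (withDensity_absolutelyContinuous _ _).ae_le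
    (ae_restrict_mem hD.isClosed.measurableSet)

section Probability

variable {Ω : Type*} [MeasurableSpace Ω] {μ : Measure Ω} [IsProbabilityMeasure μ]
  {X : ℕ → Ω → Euc d} {D : Set (Euc d)}

/-- The probability that `n` independent points do not fill `D` at scale `2 r`. -/
theorem measure_not_cover_le (hX : ∀ i, Measurable (X i)) (hindep : iIndepFun X μ) {r t : ℝ}
    (ht : 0 < t) (hball : ∀ i, ∀ y ∈ D, ENNReal.ofReal t ≤ μ.map (X i) (Metric.ball y (r / 2)))
    (n : ℕ) : μ {ω | ∃ y ∈ D, ∀ i < n, 2 * r ≤ dist (X i ω) y} ≤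
      ENNReal.ofReal (t⁻¹ * Real.exp (-(n * t))) := by
  have := Measure.isProbabilityMeasure_map (μ := μ) (hX 0).aemeasurable
  obtain ⟨S, hSD, hcov, hcard⟩ := exists_finset_cover (μ.map (X 0)) ht (hball 0)
  have hmiss : ∀ s ∈ S, μ (⋂ i ∈ Finset.range n, X i ⁻¹' (Metric.ball s r)ᶜ) ≤
      ENNReal.ofReal (Real.exp (-(n * t))) := by
    intro s hs
    rw [hindep.measure_inter_preimage_eq_mul (Finset.range n)
      (sets := fun _ => (Metric.ball s r)ᶜ) fun _ _ => measurableSet_ball.compl]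
    have h1 : ∀ i ∈ Finset.range n, μ (X i ⁻¹' (Metric.ball s r)ᶜ) ≤
        ENNReal.ofReal (Real.exp (-t)) := fun i _ => by
      have hr0 : 0 ≤ r := by
        by_contra hneg
        have h2 := hball 0 s (hSD s hs)
        rw [Metric.ball_eq_empty.2 (by linarith), measure_empty] at h2
        exact absurd (ENNReal.ofReal_eq_zero.1 (le_antisymm h2 bot_le)) (not_le.2 ht)
      rw [preimage_compl, prob_compl_eq_one_sub (hX i measurableSet_ball)]
      have h2 : ENNReal.ofReal t ≤ μ (X i ⁻¹' Metric.ball s r) := by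
        rw [← Measure.map_apply (hX i) measurableSet_ball]
        exact (hball i s (hSD s hs)).trans
          (measure_mono (Metric.ball_subset_ball (half_le_self hr0)))
      refine (tsub_le_tsub_left h2 1).trans ?_
      rw [← ENNReal.ofReal_one, ← ENNReal.ofReal_sub _ ht.le]
      exact ENNReal.ofReal_le_ofReal (by linarith [Real.add_one_le_exp (-t)])
    refine (Finset.prod_le_prod' h1).trans (le_of_eq ?_)
    rw [Finset.prod_const, Finset.card_range, ← ENNReal.ofReal_pow (Real.exp_pos _).le,
      ← Real.exp_nat_mul]
    congr 2
    ring
  -- If all samples are `2 * r` away from `y`, then none lies within `r` of a net point within `r`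
  -- of `y`. This replaces uncountably many `y` by at most `t⁻¹` events, and only monotonicity of
  -- `μ` is applied to the left side.
  have hsub : {ω | ∃ y ∈ D, ∀ i < n, 2 * r ≤ dist (X i ω) y} ⊆
      ⋃ s ∈ S, ⋂ i ∈ Finset.range n, X i ⁻¹' (Metric.ball s r)ᶜ := by
    rintro ω ⟨y, hy, hfar⟩
    obtain ⟨s, hs, hys⟩ := hcov y hy
    refine mem_biUnion hs (mem_iInter₂.2 fun i hi hmem => ?_)
    have h1 := hfar i (Finset.mem_range.1 hi)
    have h2 := dist_triangle_right (X i ω) y s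
    have h3 : dist (X i ω) s < r := hmem
    linarith
  calc μ {ω | ∃ y ∈ D, ∀ i < n, 2 * r ≤ dist (X i ω) y}
      ≤ ∑ s ∈ S, μ (⋂ i ∈ Finset.range n, X i ⁻¹' (Metric.ball s r)ᶜ) :=
        (measure_mono hsub).trans (measure_biUnion_finset_le _ _)
    _ ≤ ∑ _s ∈ S, ENNReal.ofReal (Real.exp (-(n * t))) := Finset.sum_le_sum hmiss
    _ = ENNReal.ofReal (S.card * Real.exp (-(n * t))) := by
        rw [Finset.sum_const, nsmul_eq_mul, ENNReal.ofReal_mul (Nat.cast_nonneg _),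
          ENNReal.ofReal_natCast]
    _ ≤ _ := by
        refine ENNReal.ofReal_le_ofReal ?_
        gcongr
        rw [← one_div, le_div_iff₀ ht]
        exact hcard

/-- The `d`-th power of the rate hypothesis says `log n / (n * ε n ^ d) → 0`. The factor `3` makes
`exp (-(n * t)) ≤ n ^ (-3)`, which remains summable after the net size `t⁻¹ ≤ n` is paid for. -/
theorem eventually_mul_log_le (hd : 1 ≤ d) {ε : ℕ → ℝ} (hεpos : ∀ n, 1 ≤ n → 0 < ε n)
    (hrate : Tendsto (fun n : ℕ =>
      (Real.log n) ^ (1 / (d : ℝ)) / (n : ℝ) ^ (1 / (d : ℝ)) * (1 / ε n)) atTop (𝓝 0))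
    {A : ℝ} (hA : 0 < A) : ∀ᶠ n : ℕ in atTop, 3 * Real.log n ≤ n * (A * ε n ^ d) := by
  have h1 := hrate.pow d
  rw [zero_pow (by omega)] at h1
  filter_upwards [h1.eventually_le_const (u := A / 3) (by positivity), eventually_ge_atTop 1]
    with n hn hn1
  have hn0 : (0 : ℝ) < n := by exact_mod_cast hn1
  have hε := hεpos n hn1
  have hlog : 0 ≤ Real.log n := Real.log_nonneg (by exact_mod_cast hn1)
  rw [mul_pow, div_pow, one_div (d : ℝ), Real.rpow_inv_natCast_pow hlog (by omega),
    Real.rpow_inv_natCast_pow hn0.le (by omega), div_pow, one_pow, mul_one_div, div_div,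
    div_le_iff₀ (by positivity)] at hn
  linarith

theorem ae_eventually_cover_scale (hd : 1 ≤ d) (hD : IsConvexDomain D)
    (hX : ∀ i, Measurable (X i)) (hindep : iIndepFun X μ) {ρ : Euc d → ℝ} {c : ℝ} (hc : 0 < c)
    (hρ : ∀ x ∈ D, c ≤ ρ x)
    (hlaw : ∀ i, μ.map (X i) = (volume.restrict D).withDensity (fun x => ENNReal.ofReal (ρ x)))
    {ε : ℕ → ℝ} (hεpos : ∀ n, 1 ≤ n → 0 < ε n) (hε : Tendsto ε atTop (𝓝 0))
    (hrate : Tendsto (fun n : ℕ =>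
      (Real.log n) ^ (1 / (d : ℝ)) / (n : ℝ) ^ (1 / (d : ℝ)) * (1 / ε n)) atTop (𝓝 0))
    {κ : ℝ} (hκ : 0 < κ) :
    ∀ᵐ ω ∂μ, ∀ᶠ n in atTop, ∀ y ∈ D, ∃ i < n, dist (X i ω) y < κ * ε n := by
  obtain ⟨q, R, hq, hR, hball⟩ := hD.exists_le_withDensity_ball hc hρ
  have hev : ∀ᶠ n : ℕ in atTop, μ {ω | ∃ y ∈ D, ∀ i < n, κ * ε n ≤ dist (X i ω) y} ≤
      ENNReal.ofReal (1 / (n : ℝ) ^ 2) := by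
    have t1 : Tendsto (fun n => κ / 4 * ε n) atTop (𝓝 0) := by simpa using hε.const_mul (κ / 4)
    filter_upwards [t1.eventually_le_const hR, eventually_ge_atTop 3,
      eventually_mul_log_le hd hεpos hrate (A := q * (κ / 4) ^ d) (by positivity)] with n h1 h2 h3
    have hεn := hεpos n (by omega)
    have hn0 : (0 : ℝ) < n := by exact_mod_cast (by omega : 0 < n)
    set t := q * (κ / 4 * ε n) ^ d with ht
    have ht0 : 0 < t := by positivity
    have h3' : 3 * Real.log n ≤ n * t := by
      rw [ht, mul_pow, ← mul_assoc q]; exact h3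
    have hlog : 1 ≤ Real.log n := by
      rw [Real.le_log_iff_exp_le hn0]
      have h4 : (3 : ℝ) ≤ n := by exact_mod_cast h2
      linarith [Real.exp_one_lt_d9]
    -- Radius `κ / 2 * ε n` fills `D` at scale `κ * ε n` and needs a mass bound on balls of radius
    -- `κ / 4 * ε n`, whence the `κ / 4` in `t`.
    have h5 := measure_not_cover_le (D := D) (r := κ / 2 * ε n) hX hindep ht0 (fun i y hy => by
      rw [hlaw i, show κ / 2 * ε n / 2 = κ / 4 * ε n by ring]
      exact hball y hy _ (by positivity) h1) n
    rw [show 2 * (κ / 2 * ε n) = κ * ε n by ring] at h5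
    refine h5.trans (ENNReal.ofReal_le_ofReal ?_)
    have h6 : t⁻¹ ≤ n := by
      rw [inv_le_comm₀ ht0 hn0, inv_eq_one_div, div_le_iff₀ hn0]
      linarith
    have h7 : Real.exp (-(n * t)) ≤ 1 / (n : ℝ) ^ 3 := by
      rw [Real.exp_neg, ← one_div]
      refine one_div_le_one_div_of_le (by positivity) ?_
      rw [← Real.log_le_iff_le_exp (by positivity), Real.log_pow]
      exact_mod_cast h3'
    calc t⁻¹ * Real.exp (-(n * t)) ≤ n * (1 / (n : ℝ) ^ 3) := by gcongr
      _ = 1 / (n : ℝ) ^ 2 := by field_simp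
  obtain ⟨N, hN⟩ := eventually_atTop.1 hev
  -- Borel–Cantelli is applied to the tail from `N` on, where the bound `1 / n ^ 2` is valid.
  have hsum : ∑' n : ℕ, μ {ω | ∃ y ∈ D, ∀ i < n + N, κ * ε (n + N) ≤ dist (X i ω) y} ≠ ⊤ := by
    have h1 : Summable fun n : ℕ => 1 / ((n + N : ℕ) : ℝ) ^ 2 :=
      (summable_nat_add_iff (f := fun n : ℕ => 1 / (n : ℝ) ^ 2) N).2
        (Real.summable_one_div_nat_pow.2 one_lt_two)
    exact ne_top_of_le_ne_top h1.tsum_ofReal_ne_top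
      (ENNReal.tsum_le_tsum fun n => hN (n + N) (by omega))
  filter_upwards [ae_eventually_notMem hsum] with ω hω
  obtain ⟨N', hN'⟩ := eventually_atTop.1 hω
  filter_upwards [eventually_ge_atTop (N' + N)] with n hn y hy
  have h1 := hN' (n - N) (by omega)
  rw [Nat.sub_add_cancel (by omega)] at h1
  by_contra! hcon
  exact h1 ⟨y, hy, hcon⟩

/-- The scales `1 / (k + 1)` suffice for all `κ`, so one null set serves them all. -/
theorem ae_eventually_cover (hd : 1 ≤ d) (hD : IsConvexDomain D)
    (hX : ∀ i, Measurable (X i)) (hindep : iIndepFun X μ) {ρ : Euc d → ℝ} {c : ℝ} (hc : 0 < c)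
    (hρ : ∀ x ∈ D, c ≤ ρ x)
    (hlaw : ∀ i, μ.map (X i) = (volume.restrict D).withDensity (fun x => ENNReal.ofReal (ρ x)))
    {ε : ℕ → ℝ} (hεpos : ∀ n, 1 ≤ n → 0 < ε n) (hε : Tendsto ε atTop (𝓝 0))
    (hrate : Tendsto (fun n : ℕ =>
      (Real.log n) ^ (1 / (d : ℝ)) / (n : ℝ) ^ (1 / (d : ℝ)) * (1 / ε n)) atTop (𝓝 0)) :
    ∀ᵐ ω ∂μ, ∀ κ > 0, ∀ᶠ n in atTop, ∀ y ∈ D, ∃ i < n, dist (X i ω) y < κ * ε n := by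
  have h1 : ∀ᵐ ω ∂μ, ∀ k : ℕ, ∀ᶠ n in atTop, ∀ y ∈ D, ∃ i < n,
      dist (X i ω) y < 1 / ((k : ℝ) + 1) * ε n :=
    ae_all_iff.2 fun k =>
      ae_eventually_cover_scale hd hD hX hindep hc hρ hlaw hεpos hε hrate (by positivity)
  filter_upwards [h1] with ω hω κ hκ
  obtain ⟨k, hk⟩ := exists_nat_one_div_lt hκ
  filter_upwards [hω k, eventually_ge_atTop 1] with n hn hn1 y hy
  obtain ⟨i, hi, hlt⟩ := hn y hy
  have := hεpos n hn1
  exact ⟨i, hi, hlt.trans (by gcongr)⟩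

end Probability

end GeodesicApprox

/-! ### Conclusion -/

theorem mainTheorem4 {d : ℕ} (hd : 1 ≤ d)
    (D : Set (GeodesicApprox.Euc d)) (hD : GeodesicApprox.IsConvexDomain D)
    (a b : GeodesicApprox.Euc d) (ha : a ∈ D) (hb : b ∈ D)
    (p : ℝ) (hp : 1 < p) (f : GeodesicApprox.Euc d → GeodesicApprox.Euc d → ℝ)
    (hf : GeodesicApprox.IsIntegrand D p f) (hLip : GeodesicApprox.LipCondition D p f)
    -- the i.i.d. sample with density `ρ` on `D`; `X i` is the `(i + 1)`-st point
    {Ω : Type*} [MeasurableSpace Ω] (μ : Measure Ω) [IsProbabilityMeasure μ]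
    (X : ℕ → Ω → GeodesicApprox.Euc d) (hX : ∀ i, Measurable (X i)) (hindep : iIndepFun X μ)
    (ρ : GeodesicApprox.Euc d → ℝ) (hρm : Measurable ρ)
    (hρ : ∃ c : ℝ, 0 < c ∧ ∀ x ∈ D, c ≤ ρ x ∧ ρ x ≤ c⁻¹)
    (hlaw : ∀ i, μ.map (X i) = (volume.restrict D).withDensity (fun x => ENNReal.ofReal (ρ x)))
    -- the length scales
    (ε : ℕ → ℝ) (hεpos : ∀ n, 1 ≤ n → 0 < ε n) (hε : Tendsto ε atTop (𝓝 0))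
    (hrate : Tendsto (fun n : ℕ =>
      (Real.log n) ^ (1 / (d : ℝ)) / (n : ℝ) ^ (1 / (d : ℝ)) * (1 / ε n)) atTop (𝓝 0)) :
    ∃ minF : ℝ,
      IsLeast (GeodesicApprox.pathCost f '' GeodesicApprox.lipPaths D a b) minF ∧
      ∀ᵐ ω ∂μ,
        -- the minima of `H_n` exist for all large `n` and converge to `min F`
        (∃ minH : ℕ → ℝ,
          (∀ᶠ n in atTop, IsLeast (GeodesicApprox.riemannCost f ''
            GeodesicApprox.graphPaths (fun i => X i ω) n (ε n) a b) (minH n)) ∧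
          Tendsto minH atTop (𝓝 minF)) ∧
        -- convergence of minimizers
        ∀ w : ℕ → GeodesicApprox.DiscretePath d,
          (∀ᶠ n in atTop, w n ∈ GeodesicApprox.argminOn (GeodesicApprox.riemannCost f)
            (GeodesicApprox.graphPaths (fun i => X i ω) n (ε n) a b)) →
          (∀ φ : ℕ → ℕ, StrictMono φ → ∃ ψ : ℕ → ℕ, StrictMono ψ ∧
            ∃ γ ∈ GeodesicApprox.argminOn (GeodesicApprox.pathCost f)
              (GeodesicApprox.lipPaths D a b),
              GeodesicApprox.ConvergesTo (fun k => w (φ (ψ k))) γ) ∧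
          (∀ γ ∈ GeodesicApprox.argminOn (GeodesicApprox.pathCost f)
              (GeodesicApprox.lipPaths D a b),
            (∀ η ∈ GeodesicApprox.argminOn (GeodesicApprox.pathCost f)
              (GeodesicApprox.lipPaths D a b), EqOn η γ (Icc 0 1)) →
            GeodesicApprox.ConvergesTo w γ) := by
  obtain ⟨m₁, m₂, c, h⟩ := GeodesicApprox.exists_costBounds hD hp hf hLip
  obtain ⟨γ₀, hγ₀⟩ := h.exists_pathCost_minimizer ha hb
  obtain ⟨c₀, hc₀, hρ'⟩ := hρ
  refine ⟨GeodesicApprox.pathCost f γ₀, ⟨⟨γ₀, hγ₀.1, rfl⟩, ?_⟩, ?_⟩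
  · rintro _ ⟨γ, hγ, rfl⟩
    exact hγ₀.2 γ hγ
  -- Randomness enters only through these two almost sure properties of the sample; the remainder is
  -- deterministic.
  · filter_upwards [GeodesicApprox.ae_mem_domain hD hX hlaw,
      GeodesicApprox.ae_eventually_cover hd hD hX hindep hc₀ (fun x hx => (hρ' x hx).1) hlaw
        hεpos hε hrate] with ω hmem hcover
    exact h.convergence_of_covering (hD.nontrivial hd) ha hb hmem
      (eventually_atTop.2 ⟨1, hεpos⟩) hε hcover hγ₀
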